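/- Let $K$ be a field of characteristic $0$ (for instance $K=\mathbb{Q}(l,r)$ with $l,r$ nonzero complex numbers), let $l,r\in K$ be nonzero, put $m=\frac1r-r$, and assume $r^{2k}\notin\{1,-1\}$ for $k=1,2,3$ and $r^{8}\neq 1$ (the conditions for semisimplicity of the Hecke algebras, with parameter $r^2$, of type $D_4$ and of $\mathrm{Sym}(4)$). The CGW algebra (generalised Birman--Murakami--Wenzl algebra) of type $D_4$ is the unital $K$-algebra with generators $g_i,e_i$, $1\le i\le 4$, where node $3$ of the Dynkin diagram is joined to nodes $1,2,4$, and relations: $g_ig_j=g_jg_i$ for $i,j$ not adjacent; $g_ig_jg_i=g_jg_ig_j$ for $i,j$ adjacent; $m\,e_i=l\,(g_i^2+m\,g_i-1)$; $g_ie_i=\frac1l e_i$; $e_ig_je_i=l\,e_i$ for $i,j$ adjacent. The Cohen--Wales space $V_4$ is the $12$-dimensional $K$-vector space with basis $w_{ij},\widehat{w}_{ij}$ $(1\le i<j\le 4)$, with the Cohen--Wales representation $\nu^{(4)}$ of the CGW algebra of type $D_4$, given as follows. * $g_1$: $w_{12}\mapsto r w_{12}$; $w_{34}\mapsto r w_{34}$;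 $\widehat w_{12}\mapsto\frac1l\widehat w_{12}$; $\widehat w_{13}\mapsto w_{23}$; $\widehat w_{14}\mapsto w_{24}$; $w_{13}\mapsto \widehat w_{23}+m\widehat w_{13}-m w_{13}+\frac mr(\widehat w_{12}-w_{12})$; $w_{14}\mapsto \widehat w_{24}+m\widehat w_{14}-m w_{14}+m(\widehat w_{12}-w_{12})$; $w_{23}\mapsto\widehat w_{13}-m w_{23}+m\widehat w_{12}$; $w_{24}\mapsto\widehat w_{14}-m w_{24}+mr\,\widehat w_{12}$; $\widehat w_{23}\mapsto w_{13}-m w_{23}+m w_{12}$; $\widehat w_{24}\mapsto w_{14}-m w_{24}+mr\,w_{12}$; $\widehat w_{34}\mapsto r\widehat w_{34}+mr(\widehat w_{24}-w_{24})+m(\widehat w_{14}-w_{14})+m(\widehat w_{23}-w_{23})+\frac mr(\widehat w_{13}-w_{13})+m^2(r+\frac1r)(\widehat w_{12}-w_{12})$. * $g_2$: $w_{12}\mapsto\frac1l w_{12}$; $w_{34},\widehat w_{12},\widehat w_{34}$ are multiplied by $r$; $w_{13}\mapsto w_{23}$; $w_{14}\mapsto w_{24}$; $\widehat w_{13}\mapsto\widehat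 w_{23}$; $\widehat w_{14}\mapsto\widehat w_{24}$; $w_{23}\mapsto w_{13}-m w_{23}+m w_{12}$; $w_{24}\mapsto w_{14}-m w_{24}+mr\,w_{12}$; $\widehat w_{23}\mapsto\widehat w_{13}-m\widehat w_{23}+\frac{m}{lr}w_{12}$; $\widehat w_{24}\mapsto\widehat w_{14}-m\widehat w_{24}+\frac ml w_{12}$. * $g_3$: $w_{23}\mapsto\frac1l w_{23}$; $w_{14},\widehat w_{14},\widehat w_{23}$ are multiplied by $r$; $w_{12}\mapsto w_{13}$; $w_{24}\mapsto w_{34}$; $\widehat w_{12}\mapsto\widehat w_{13}$; $\widehat w_{24}\mapsto\widehat w_{34}$; $w_{13}\mapsto w_{12}-m w_{13}+\frac ml w_{23}$; $w_{34}\mapsto w_{24}-m w_{34}+m w_{23}$; $\widehat w_{13}\mapsto\widehat w_{12}-m\widehat w_{13}+\frac ml w_{23}$; $\widehat w_{34}\mapsto\widehat w_{24}-m\widehat w_{34}+\frac m{lr}w_{23}$. * $g_4$: $w_{34}\mapsto\frac1l w_{34}$; $w_{12},\widehat w_{12},\widehat w_{34}$ are multiplied by $r$; $w_{13}\mapsto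 w_{14}$; $w_{23}\mapsto w_{24}$; $\widehat w_{13}\mapsto\widehat w_{14}$; $\widehat w_{23}\mapsto\widehat w_{24}$; $w_{14}\mapsto w_{13}-m w_{14}+\frac m{lr}w_{34}$; $w_{24}\mapsto w_{23}-m w_{24}+\frac ml w_{34}$; $\widehat w_{14}\mapsto\widehat w_{13}-m\widehat w_{14}+\frac m{lr}w_{34}$; $\widehat w_{24}\mapsto\widehat w_{23}-m\widehat w_{24}+\frac ml w_{34}$. Each $e_i$ acts as $\frac lm(g_i^2+m g_i-1)$. An invariant subspace is a subspace stable under the whole algebra; it is irreducible if it is nonzero and contains no invariant subspace other than $0$ and itself. Then $V_4$ contains an irreducible $3$-dimensional invariant subspace if and only if $l=\frac1r$. If $l=\frac1r$, then $V_4$ contains exactly three irreducible invariant subspaces of dimension $3$. With $t_{ij}=w_{ij}-\widehat w_{ij}$, they are respectively spanned by * $u_1=m\,t_{12}+t_{13}+t_{24}$, $u_2=(1-r^2)t_{12}+t_{23}+t_{14}-m\,t_{24}$, $u_3=t_{12}+t_{34}$; * $w_1=-t_{13}+m\,t_{23}+t_{24}$, $w_2=-t_{12}+m\,t_{13}+(1-r^2)t_{23}+t_{34}$,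 $w_3=-t_{23}+t_{14}$; * $v_1=(\frac1r-r^3)w_{12}+(w_{13}-\frac1r w_{23})+r(w_{14}-\frac1r w_{24})+r^2(\widehat w_{13}-\frac1r\widehat w_{23})+r^3(\widehat w_{14}-\frac1r\widehat w_{24})$, $v_2=(\frac1r-r^3)w_{23}+(w_{24}-\frac1r w_{34})+r^3(w_{12}-\frac1r w_{13})+r(\widehat w_{12}-\frac1r\widehat w_{13})+r^2(\widehat w_{24}-\frac1r\widehat w_{34})$, $v_3=(\frac1r-r^3)w_{34}+r^2(w_{13}-\frac1r w_{14})+r^3(w_{23}-\frac1r w_{24})+(\widehat w_{13}-\frac1r\widehat w_{14})+r(\widehat w_{23}-\frac1r\widehat w_{24})$. -/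

import Mathlib

namespace CohenWales

/-- The nodes of the Dynkin diagram of type `D₄`. The node `n3` is joined to each of the other
three nodes, and there is no other edge. -/
inductive Node
  | n1 | n2 | n3 | n4
  deriving DecidableEq

/-- Two nodes are adjacent when they are distinct and one of them is the central node. -/
def Node.Adj (i j : Node) : Prop := i ≠ j ∧ (i = .n3 ∨ j = .n3)

/-- The parameter `m = 1/r - r`. -/
def mParam {K : Type*} [Field K] (r : K) : K := r⁻¹ - r

/-- The generators `g_i`, `e_i` of the CGW algebra. -/
inductive Gen
  | g (i : Node)
  | e (i : Node)

/-- The defining relations of the CGW algebra (the generalised Birman-Murakami-Wenzl algebra)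
of type `D₄` with parameters `l` and `m = 1/r - r`. The inverse of `g_i` need not be adjoined:
the relations give `g_i * (g_i + m - m e_i) = 1`. -/
inductive CGWRel {K : Type*} [Field K] (r l : K) :
    FreeAlgebra K Gen → FreeAlgebra K Gen → Prop
  | comm (i j : Node) (h : ¬ i.Adj j) :
      CGWRel r l (FreeAlgebra.ι K (.g i) * FreeAlgebra.ι K (.g j))
        (FreeAlgebra.ι K (.g j) * FreeAlgebra.ι K (.g i))
  | braid (i j : Node) (h : i.Adj j) :
      CGWRel r l
        (FreeAlgebra.ι K (.g i) * FreeAlgebra.ι K (.g j) * FreeAlgebra.ι K (.g i))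
        (FreeAlgebra.ι K (.g j) * FreeAlgebra.ι K (.g i) * FreeAlgebra.ι K (.g j))
  | quad (i : Node) :
      CGWRel r l (mParam r • FreeAlgebra.ι K (.e i))
        (l • (FreeAlgebra.ι K (.g i) * FreeAlgebra.ι K (.g i)
          + mParam r • FreeAlgebra.ι K (.g i) - 1))
  | ge (i : Node) :
      CGWRel r l (FreeAlgebra.ι K (.g i) * FreeAlgebra.ι K (.e i))
        (l⁻¹ • FreeAlgebra.ι K (.e i))
  | ege (i j : Node) (h : i.Adj j) :
      CGWRel r l
        (FreeAlgebra.ι K (.e i) * FreeAlgebra.ι K (.g j) * FreeAlgebra.ι K (.e i))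
        (l • FreeAlgebra.ι K (.e i))

/-- The CGW algebra of type `D₄`. -/
abbrev CGW {K : Type*} [Field K] (r l : K) : Type _ := RingQuot (CGWRel r l)

/-- Labels of the twelve basis vectors: `wij` stands for `w_{ij}` and `hij` for `ŵ_{ij}`,
`1 ≤ i < j ≤ 4`. -/
inductive Idx
  | w12 | w13 | w14 | w23 | w24 | w34
  | h12 | h13 | h14 | h23 | h24 | h34
  deriving DecidableEq

instance : Fintype Idx :=
  ⟨{.w12, .w13, .w14, .w23, .w24, .w34, .h12, .h13, .h14, .h23, .h24, .h34},
    by intro x; cases x <;> decide⟩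

/-- The Cohen-Wales space `V₄`, of dimension `4² - 4 = 12`. -/
abbrev V4 (K : Type*) : Type _ := Idx → K

/-- The basis vector of `V₄` with a given label. -/
def bv (K : Type*) [Field K] (s : Idx) : V4 K := Pi.single s 1

/-- The images of the basis vectors under the generators `g_1, g_2, g_3, g_4`. -/
def gImage {K : Type*} [Field K] (r l : K) : Node → Idx → V4 K
  | .n1, .w12 => r • bv K .w12
  | .n1, .w13 => bv K .h23 + mParam r • bv K .h13 - mParam r • bv K .w13
      + (mParam r * r⁻¹) • (bv K .h12 - bv K .w12)
  | .n1, .w14 => bv K .h24 + mParam r • bv K .h14 - mParam r • bv K .w14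
      + mParam r • (bv K .h12 - bv K .w12)
  | .n1, .w23 => bv K .h13 - mParam r • bv K .w23 + mParam r • bv K .h12
  | .n1, .w24 => bv K .h14 - mParam r • bv K .w24 + (mParam r * r) • bv K .h12
  | .n1, .w34 => r • bv K .w34
  | .n1, .h12 => l⁻¹ • bv K .h12
  | .n1, .h13 => bv K .w23
  | .n1, .h14 => bv K .w24
  | .n1, .h23 => bv K .w13 - mParam r • bv K .w23 + mParam r • bv K .w12
  | .n1, .h24 => bv K .w14 - mParam r • bv K .w24 + (mParam r * r) • bv K .w12
  | .n1, .h34 => r • bv K .h34 + (mParam r * r) • (bv K .h24 - bv K .w24)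
      + mParam r • (bv K .h14 - bv K .w14) + mParam r • (bv K .h23 - bv K .w23)
      + (mParam r * r⁻¹) • (bv K .h13 - bv K .w13)
      + (mParam r ^ 2 * (r + r⁻¹)) • (bv K .h12 - bv K .w12)
  | .n2, .w12 => l⁻¹ • bv K .w12
  | .n2, .w13 => bv K .w23
  | .n2, .w14 => bv K .w24
  | .n2, .w23 => bv K .w13 - mParam r • bv K .w23 + mParam r • bv K .w12
  | .n2, .w24 => bv K .w14 - mParam r • bv K .w24 + (mParam r * r) • bv K .w12
  | .n2, .w34 => r • bv K .w34
  | .n2, .h12 => r • bv K .h12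
  | .n2, .h13 => bv K .h23
  | .n2, .h14 => bv K .h24
  | .n2, .h23 => bv K .h13 - mParam r • bv K .h23 + (mParam r * l⁻¹ * r⁻¹) • bv K .w12
  | .n2, .h24 => bv K .h14 - mParam r • bv K .h24 + (mParam r * l⁻¹) • bv K .w12
  | .n2, .h34 => r • bv K .h34
  | .n3, .w12 => bv K .w13
  | .n3, .w13 => bv K .w12 - mParam r • bv K .w13 + (mParam r * l⁻¹) • bv K .w23
  | .n3, .w14 => r • bv K .w14
  | .n3, .w23 => l⁻¹ • bv K .w23
  | .n3, .w24 => bv K .w34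
  | .n3, .w34 => bv K .w24 - mParam r • bv K .w34 + mParam r • bv K .w23
  | .n3, .h12 => bv K .h13
  | .n3, .h13 => bv K .h12 - mParam r • bv K .h13 + (mParam r * l⁻¹) • bv K .w23
  | .n3, .h14 => r • bv K .h14
  | .n3, .h23 => r • bv K .h23
  | .n3, .h24 => bv K .h34
  | .n3, .h34 => bv K .h24 - mParam r • bv K .h34 + (mParam r * l⁻¹ * r⁻¹) • bv K .w23
  | .n4, .w12 => r • bv K .w12
  | .n4, .w13 => bv K .w14
  | .n4, .w14 => bv K .w13 - mParam r • bv K .w14 + (mParam r * l⁻¹ * r⁻¹) • bv K .w34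
  | .n4, .w23 => bv K .w24
  | .n4, .w24 => bv K .w23 - mParam r • bv K .w24 + (mParam r * l⁻¹) • bv K .w34
  | .n4, .w34 => l⁻¹ • bv K .w34
  | .n4, .h12 => r • bv K .h12
  | .n4, .h13 => bv K .h14
  | .n4, .h14 => bv K .h13 - mParam r • bv K .h14 + (mParam r * l⁻¹ * r⁻¹) • bv K .w34
  | .n4, .h23 => bv K .h24
  | .n4, .h24 => bv K .h23 - mParam r • bv K .h24 + (mParam r * l⁻¹) • bv K .w34
  | .n4, .h34 => r • bv K .h34

/-- The action of `g_i` on `V₄`. -/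
noncomputable def gOp {K : Type*} [Field K] (r l : K) (i : Node) : Module.End K (V4 K) :=
  (Pi.basisFun K Idx).constr K (gImage r l i)

/-- The action of `e_i = (l / m) (g_i² + m g_i - 1)` on `V₄`. -/
noncomputable def eOp {K : Type*} [Field K] (r l : K) (i : Node) : Module.End K (V4 K) :=
  (l * (mParam r)⁻¹) • (gOp r l i * gOp r l i + mParam r • gOp r l i - 1)

theorem gOp_bv {K : Type*} [Field K] (r l : K) (i : Node) (s : Idx) :
    gOp r l i (bv K s) = gImage r l i s := by
  have h : bv K s = Pi.basisFun K Idx s := by simp [bv]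
  rw [gOp, h, Module.Basis.constr_basis]

theorem end_ext {K : Type*} [Field K] {f g : Module.End K (V4 K)}
    (h : ∀ s, f (bv K s) = g (bv K s)) : f = g := by
  refine (Pi.basisFun K Idx).ext fun s => ?_
  have hs : Pi.basisFun K Idx s = bv K s := by simp [bv]
  rw [hs]
  exact h s

theorem mParam_ne_zero {K : Type*} [Field K] {r : K} (hr : r ≠ 0) (hr2 : r ^ 2 ≠ 1) :
    mParam r ≠ 0 := by
  intro h
  apply hr2
  have h1 : r⁻¹ = r := sub_eq_zero.mp h
  calc r ^ 2 = r * r⁻¹ := by rw [h1, sq]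
    _ = 1 := mul_inv_cancel₀ hr

set_option maxHeartbeats 4000000 in
theorem gOp_comm {K : Type*} [Field K] {r l : K} (hr : r ≠ 0) (hl : l ≠ 0) (i j : Node)
    (h : ¬ i.Adj j) : gOp r l i * gOp r l j = gOp r l j * gOp r l i := by
  apply end_ext
  intro s
  cases i <;> cases j <;> first
    | rfl
    | exact absurd ⟨by decide, by decide⟩ h
    | (cases s <;>
        simp only [Module.End.mul_apply, gOp_bv, gImage, map_add, map_sub, map_smul] <;>
        match_scalars <;> (try simp only [mParam]) <;> (try field_simp) <;> (try ring))

set_option maxHeartbeats 4000000 in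
theorem gOp_braid {K : Type*} [Field K] {r l : K} (hr : r ≠ 0) (hl : l ≠ 0) (i j : Node)
    (h : i.Adj j) :
    gOp r l i * gOp r l j * gOp r l i = gOp r l j * gOp r l i * gOp r l j := by
  apply end_ext
  intro s
  cases i <;> cases j <;> first
    | exact absurd rfl h.1
    | exact absurd h.2 (by decide)
    | (cases s <;>
        simp only [Module.End.mul_apply, gOp_bv, gImage, map_add, map_sub, map_smul] <;>
        match_scalars <;> (try simp only [mParam]) <;> (try field_simp) <;> (try ring))

/-- The label of the basis vector spanning the image of `e_i`. -/
def Node.root : Node → Idx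
  | .n1 => .h12
  | .n2 => .w12
  | .n3 => .w23
  | .n4 => .w34

/-- The coefficient of `e_i` on a basis vector. -/
def eCoeff {K : Type*} [Field K] (r l : K) : Node → Idx → K
  | .n1, .w12 => 0
  | .n1, .w13 => r⁻¹
  | .n1, .w14 => 1
  | .n1, .w23 => 1
  | .n1, .w24 => r
  | .n1, .w34 => 0
  | .n1, .h12 => 1 - (l - l⁻¹) * (mParam r)⁻¹
  | .n1, .h13 => l
  | .n1, .h14 => r * l
  | .n1, .h23 => r * l
  | .n1, .h24 => r ^ 2 * l
  | .n1, .h34 => mParam r * (r + r⁻¹) * (1 - l * r)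
  | .n2, .w12 => 1 - (l - l⁻¹) * (mParam r)⁻¹
  | .n2, .w13 => l
  | .n2, .w14 => r * l
  | .n2, .w23 => 1
  | .n2, .w24 => r
  | .n2, .w34 => 0
  | .n2, .h12 => 0
  | .n2, .h13 => r⁻¹
  | .n2, .h14 => 1
  | .n2, .h23 => r⁻¹ * l⁻¹
  | .n2, .h24 => l⁻¹
  | .n2, .h34 => 0
  | .n3, .w12 => 1
  | .n3, .w13 => l⁻¹
  | .n3, .w14 => 0
  | .n3, .w23 => 1 - (l - l⁻¹) * (mParam r)⁻¹
  | .n3, .w24 => l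
  | .n3, .w34 => 1
  | .n3, .h12 => 1
  | .n3, .h13 => l⁻¹
  | .n3, .h14 => 0
  | .n3, .h23 => 0
  | .n3, .h24 => r⁻¹
  | .n3, .h34 => r⁻¹ * l⁻¹
  | .n4, .w12 => 0
  | .n4, .w13 => r⁻¹
  | .n4, .w14 => r⁻¹ * l⁻¹
  | .n4, .w23 => 1
  | .n4, .w24 => l⁻¹
  | .n4, .w34 => 1 - (l - l⁻¹) * (mParam r)⁻¹
  | .n4, .h12 => 0
  | .n4, .h13 => r⁻¹
  | .n4, .h14 => r⁻¹ * l⁻¹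
  | .n4, .h23 => 1
  | .n4, .h24 => l⁻¹
  | .n4, .h34 => 0

set_option maxHeartbeats 4000000 in
theorem quad_bv {K : Type*} [Field K] {r l : K} (hr : r ≠ 0) (hl : l ≠ 0)
    (hm : mParam r ≠ 0) (i : Node) (s : Idx) :
    l • (gOp r l i * gOp r l i + mParam r • gOp r l i - 1) (bv K s)
      = (mParam r * eCoeff r l i s) • bv K i.root := by
  have hδ : mParam r * (1 - (l - l⁻¹) * (mParam r)⁻¹) = mParam r - (l - l⁻¹) := by
    field_simp
  cases i <;> cases s <;>
    simp only [LinearMap.sub_apply, LinearMap.add_apply, LinearMap.smul_apply,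
      Module.End.one_apply, Module.End.mul_apply, gOp_bv, gImage, map_add, map_sub, map_smul,
      eCoeff, Node.root, hδ] <;>
    match_scalars <;> (try simp only [mParam]) <;> (try field_simp) <;> (try ring)

theorem eOp_bv {K : Type*} [Field K] {r l : K} (hr : r ≠ 0) (hl : l ≠ 0)
    (hm : mParam r ≠ 0) (i : Node) (s : Idx) :
    eOp r l i (bv K s) = eCoeff r l i s • bv K i.root := by
  rw [eOp, mul_comm, LinearMap.smul_apply, mul_smul, quad_bv hr hl hm, smul_smul,
    inv_mul_cancel_left₀ hm]

theorem gOp_root {K : Type*} [Field K] (r l : K) (i : Node) :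
    gOp r l i (bv K i.root) = l⁻¹ • bv K i.root := by
  rw [gOp_bv]
  cases i <;> rfl

theorem eOp_gOp_root {K : Type*} [Field K] {r l : K} (hr : r ≠ 0) (hl : l ≠ 0)
    (hm : mParam r ≠ 0) (i j : Node) (h : i.Adj j) :
    eOp r l i (gOp r l j (bv K i.root)) = l • bv K i.root := by
  have hδ : mParam r * (1 - (l - l⁻¹) * (mParam r)⁻¹) = mParam r - (l - l⁻¹) := by
    field_simp
  rw [gOp_bv]
  cases i <;> cases j <;> first
    | exact absurd rfl h.1
    | exact absurd h.2 (by decide)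
    | (simp only [gImage, Node.root, map_add, map_sub, map_smul, eOp_bv hr hl hm, eCoeff,
          smul_smul, hδ] <;>
        match_scalars <;> (try simp only [mParam]) <;> (try field_simp) <;> (try ring))

/-- The operators assigned to the generators of the CGW algebra. -/
noncomputable def genOp {K : Type*} [Field K] (r l : K) : Gen → Module.End K (V4 K)
  | .g i => gOp r l i
  | .e i => eOp r l i

theorem genOp_rel {K : Type*} [Field K] {r l : K} (hr : r ≠ 0) (hl : l ≠ 0)
    (hr2 : r ^ 2 ≠ 1) ⦃a b : FreeAlgebra K Gen⦄ (h : CGWRel r l a b) :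
    FreeAlgebra.lift K (genOp r l) a = FreeAlgebra.lift K (genOp r l) b := by
  have hm := mParam_ne_zero hr hr2
  cases h with
  | comm i j h => simpa [genOp] using gOp_comm hr hl i j h
  | braid i j h => simpa [genOp] using gOp_braid hr hl i j h
  | quad i =>
    simp only [map_smul, map_add, map_sub, map_mul, map_one, FreeAlgebra.lift_ι_apply, genOp,
      eOp, smul_smul]
    rw [mul_left_comm, mul_inv_cancel₀ hm, mul_one]
  | ge i =>
    simp only [map_smul, map_mul, FreeAlgebra.lift_ι_apply, genOp]
    apply end_ext
    intro s
    rw [Module.End.mul_apply, LinearMap.smul_apply, eOp_bv hr hl hm, map_smul, gOp_root,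
      smul_comm]
  | ege i j h =>
    simp only [map_smul, map_mul, FreeAlgebra.lift_ι_apply, genOp]
    apply end_ext
    intro s
    rw [Module.End.mul_apply, Module.End.mul_apply, LinearMap.smul_apply, eOp_bv hr hl hm,
      map_smul, map_smul, eOp_gOp_root hr hl hm i j h, smul_comm]

/-- The Cohen-Wales representation `ν⁽⁴⁾` of the CGW algebra of type `D₄` on `V₄`. -/
noncomputable def nu {K : Type*} [Field K] (r l : K) (hr : r ≠ 0) (hl : l ≠ 0)
    (hr2 : r ^ 2 ≠ 1) : CGW r l →ₐ[K] Module.End K (V4 K) :=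
  RingQuot.liftAlgHom K ⟨FreeAlgebra.lift K (genOp r l), genOp_rel hr hl hr2⟩

theorem nu_gen {K : Type*} [Field K] (r l : K) (hr : r ≠ 0) (hl : l ≠ 0) (hr2 : r ^ 2 ≠ 1)
    (x : Gen) :
    nu r l hr hl hr2 (RingQuot.mkAlgHom K (CGWRel r l) (FreeAlgebra.ι K x)) = genOp r l x := by
  simp [nu]

/-- `W` is invariant under a representation `ρ`. -/
def IsInvariant {K A V : Type*} [Field K] [Ring A] [Algebra K A] [AddCommGroup V] [Module K V]
    (ρ : A →ₐ[K] Module.End K V) (W : Submodule K V) : Prop :=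
  ∀ a : A, ∀ v ∈ W, ρ a v ∈ W

/-- `W` is a nonzero invariant subspace whose only invariant subspaces are `0` and `W`. -/
def IsIrreducibleInvariant {K A V : Type*} [Field K] [Ring A] [Algebra K A] [AddCommGroup V]
    [Module K V] (ρ : A →ₐ[K] Module.End K V) (W : Submodule K V) : Prop :=
  IsInvariant ρ W ∧ W ≠ ⊥ ∧ ∀ U : Submodule K V, U ≤ W → IsInvariant ρ U → U = ⊥ ∨ U = W

/-- The vectors `u_1, u_2, u_3`. -/
def uVec {K : Type*} [Field K] (r : K) : Fin 3 → V4 K :=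
  ![mParam r • (bv K .w12 - bv K .h12) + (bv K .w13 - bv K .h13) + (bv K .w24 - bv K .h24),
    (1 - r ^ 2) • (bv K .w12 - bv K .h12) + (bv K .w23 - bv K .h23) + (bv K .w14 - bv K .h14)
      - mParam r • (bv K .w24 - bv K .h24),
    (bv K .w12 - bv K .h12) + (bv K .w34 - bv K .h34)]

/-- The vectors `w_1, w_2, w_3`. -/
def wVec {K : Type*} [Field K] (r : K) : Fin 3 → V4 K :=
  ![-(bv K .w13 - bv K .h13) + mParam r • (bv K .w23 - bv K .h23) + (bv K .w24 - bv K .h24),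
    -(bv K .w12 - bv K .h12) + mParam r • (bv K .w13 - bv K .h13)
      + (1 - r ^ 2) • (bv K .w23 - bv K .h23) + (bv K .w34 - bv K .h34),
    -(bv K .w23 - bv K .h23) + (bv K .w14 - bv K .h14)]

/-- The vectors `v_1, v_2, v_3`. When `l = 1/r` they satisfy `g_1 v_i = g_2 v_i`,
`g_{i+1} v_i = -r⁻¹ v_i`, `g_{i+2} v_i = r (v_i + v_{i+1})`, `g_{i+1} v_{i+1} = r v_{i+1} + r⁻¹ v_i`
and `g_{j+1} v_i = r v_i` for the remaining `1 ≤ j ≤ 3`. -/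
def vVec {K : Type*} [Field K] (r : K) : Fin 3 → V4 K :=
  ![(r⁻¹ - r ^ 3) • bv K .w12 + (bv K .w13 - r⁻¹ • bv K .w23)
      + r • (bv K .w14 - r⁻¹ • bv K .w24) + r ^ 2 • (bv K .h13 - r⁻¹ • bv K .h23)
      + r ^ 3 • (bv K .h14 - r⁻¹ • bv K .h24),
    (r⁻¹ - r ^ 3) • bv K .w23 + (bv K .w24 - r⁻¹ • bv K .w34)
      + r ^ 3 • (bv K .w12 - r⁻¹ • bv K .w13) + r • (bv K .h12 - r⁻¹ • bv K .h13)
      + r ^ 2 • (bv K .h24 - r⁻¹ • bv K .h34),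
    (r⁻¹ - r ^ 3) • bv K .w34 + r ^ 2 • (bv K .w13 - r⁻¹ • bv K .w14)
      + r ^ 3 • (bv K .w23 - r⁻¹ • bv K .w24) + (bv K .h13 - r⁻¹ • bv K .h14)
      + r • (bv K .h23 - r⁻¹ • bv K .h24)]

end CohenWales

/-!
Write `m = 1/r - r`. An invariant subspace `W` on which some `e_i` does not vanish contains a root
vector, hence all of them, and then everything (`eq_top_of_root_mem`). So a three-dimensional `W` is
killed by all `e_i`, and each `g_i` satisfies `g_i² + m g_i = 1` on it, with possible eigenvalues
`r` and `-1/r`. The generators `g₁, g₂, g₄` commute. If they all agreed on an irreducible `W`, then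
`W` would be a module over the Hecke algebra of type `A₂`, of dimension at most `2`
(`not_outer_eq`). So `W` contains a joint eigenvector of `g₁, g₂, g₄` on which they have different
eigenvalues (`exists_nonconstant_eigenvector`).

For each of the six patterns of eigenvalues, the eigenvector equations together with the vanishing
of `e₃` determine this vector up to a scalar and one unknown coordinate `β`
(`eq_smul_orbitVec`). Applying `g₃` and then two of the outer generators gives four vectors of `W`,
and since `W` has dimension `3` their minors vanish, which forces `l = 1/r`
(`eq_one_div_of_orbitVec_mem`).

For `l = 1/r`, the spans of the `u_i`, of the `w_i` and of the `v_i` have bases on which the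
generators act as in the reduced Burau representation; this gives irreducibility and the dimension
(`irreducible_of_chain`). The equation `e₃ = 0` now determines `β`, and each of the six joint
eigenvectors lies in one of these subspaces (`orbitVec_mem`), so `W` shares a nonzero vector with
one of them and is equal to it. The three subspaces differ because the pair of outer generators that
agree is a different one on each (`spans_ne`).
-/

namespace CohenWales

variable {K : Type*} [Field K] {r l : K}

/-! ### The action in coordinates -/

/-- The coordinates of `g_i v` in terms of those of `v`: the transpose of the table `gImage`. -/
def gCoord (r l : K) (i : Node) (v : V4 K) (s : Idx) : K :=
  match i, s with
  | .n1, .w12 => r * v .w12 + mParam r * v .h23 + mParam r * r * v .h24 - mParam r * r⁻¹ * v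
      .w13 - mParam r * v .w14 - mParam r ^ 2 * (r + r⁻¹) * v .h34
  | .n1, .w13 => v .h23 - mParam r * v .w13 - mParam r * r⁻¹ * v .h34
  | .n1, .w14 => v .h24 - mParam r * v .w14 - mParam r * v .h34
  | .n1, .w23 => v .h13 - mParam r * v .w23 - mParam r * v .h23 - mParam r * v .h34
  | .n1, .w24 => v .h14 - mParam r * v .w24 - mParam r * v .h24 - mParam r * r * v .h34
  | .n1, .w34 => r * v .w34
  | .n1, .h12 => mParam r * r⁻¹ * v .w13 + mParam r * v .w14 + mParam r * v .w23 + mParam r *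
      r * v .w24 + l⁻¹ * v .h12 + mParam r ^ 2 * (r + r⁻¹) * v .h34
  | .n1, .h13 => mParam r * v .w13 + v .w23 + mParam r * r⁻¹ * v .h34
  | .n1, .h14 => mParam r * v .w14 + v .w24 + mParam r * v .h34
  | .n1, .h23 => v .w13 + mParam r * v .h34
  | .n1, .h24 => v .w14 + mParam r * r * v .h34
  | .n1, .h34 => r * v .h34
  | .n2, .w12 => l⁻¹ * v .w12 + mParam r * v .w23 + mParam r * r * v .w24 + mParam r * l⁻¹ *
      r⁻¹ * v .h23 + mParam r * l⁻¹ * v .h24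
  | .n2, .w13 => v .w23
  | .n2, .w14 => v .w24
  | .n2, .w23 => v .w13 - mParam r * v .w23
  | .n2, .w24 => v .w14 - mParam r * v .w24
  | .n2, .w34 => r * v .w34
  | .n2, .h12 => r * v .h12
  | .n2, .h13 => v .h23
  | .n2, .h14 => v .h24
  | .n2, .h23 => v .h13 - mParam r * v .h23
  | .n2, .h24 => v .h14 - mParam r * v .h24
  | .n2, .h34 => r * v .h34
  | .n3, .w12 => v .w13
  | .n3, .w13 => v .w12 - mParam r * v .w13
  | .n3, .w14 => r * v .w14
  | .n3, .w23 => mParam r * l⁻¹ * v .w13 + l⁻¹ * v .w23 + mParam r * v .w34 + mParam r * l⁻¹ *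
      v .h13 + mParam r * l⁻¹ * r⁻¹ * v .h34
  | .n3, .w24 => v .w34
  | .n3, .w34 => v .w24 - mParam r * v .w34
  | .n3, .h12 => v .h13
  | .n3, .h13 => v .h12 - mParam r * v .h13
  | .n3, .h14 => r * v .h14
  | .n3, .h23 => r * v .h23
  | .n3, .h24 => v .h34
  | .n3, .h34 => v .h24 - mParam r * v .h34
  | .n4, .w12 => r * v .w12
  | .n4, .w13 => v .w14
  | .n4, .w14 => v .w13 - mParam r * v .w14
  | .n4, .w23 => v .w24
  | .n4, .w24 => v .w23 - mParam r * v .w24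
  | .n4, .w34 => mParam r * l⁻¹ * r⁻¹ * v .w14 + mParam r * l⁻¹ * v .w24 + l⁻¹ * v .w34 +
      mParam r * l⁻¹ * r⁻¹ * v .h14 + mParam r * l⁻¹ * v .h24
  | .n4, .h12 => r * v .h12
  | .n4, .h13 => v .h14
  | .n4, .h14 => v .h13 - mParam r * v .h14
  | .n4, .h23 => v .h24
  | .n4, .h24 => v .h23 - mParam r * v .h24
  | .n4, .h34 => r * v .h34

theorem sum_idx {M : Type*} [AddCommMonoid M] (f : Idx → M) :
    ∑ s, f s = f .w12 + (f .w13 + (f .w14 + (f .w23 + (f .w24 + (f .w34 + (f .h12 + (f .h13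
      + (f .h14 + (f .h23 + (f .h24 + f .h34)))))))))) := by
  have h : (Finset.univ : Finset Idx) = {.w12, .w13, .w14, .w23, .w24, .w34, .h12, .h13, .h14,
    .h23, .h24, .h34} := rfl
  rw [h]
  repeat rw [Finset.sum_insert (by decide)]
  rw [Finset.sum_singleton]

theorem eq_sum_bv (v : V4 K) : v = ∑ s, v s • bv K s := by
  ext t
  simp [bv, Finset.sum_apply, Pi.single_apply]

theorem gOp_eq_gCoord (i : Node) (v : V4 K) : gOp r l i v = gCoord r l i v := by
  conv_lhs => rw [eq_sum_bv v]
  simp only [map_sum, map_smul, gOp_bv]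
  ext t
  rw [sum_idx]
  cases i <;> cases t <;>
    simp [gImage, gCoord, bv] <;> ring

/-! ### Invariant subspaces -/

theorem isInvariant_iff (hr : r ≠ 0) (hl : l ≠ 0) (hr2 : r ^ 2 ≠ 1)
    (W : Submodule K (V4 K)) :
    IsInvariant (nu r l hr hl hr2) W ↔ ∀ i, ∀ v ∈ W, gOp r l i v ∈ W := by
  constructor
  · intro h i v hv
    have := h (RingQuot.mkAlgHom K (CGWRel r l) (FreeAlgebra.ι K (.g i))) v hv
    rwa [nu_gen] at this
  · intro h a
    obtain ⟨x, rfl⟩ := RingQuot.mkAlgHom_surjective K (CGWRel r l) a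
    induction x using FreeAlgebra.induction with
    | grade0 c =>
      intro v hv
      simpa [Algebra.algebraMap_eq_smul_one] using W.smul_mem c hv
    | grade1 x =>
      intro v hv
      rw [nu_gen]
      cases x with
      | g i => exact h i v hv
      | e i =>
        simp only [genOp, eOp, LinearMap.smul_apply, LinearMap.sub_apply, LinearMap.add_apply,
          Module.End.mul_apply, Module.End.one_apply]
        exact W.smul_mem _ (W.sub_mem (W.add_mem (h i _ (h i v hv))
          (W.smul_mem _ (h i v hv))) hv)
    | mul a b ha hb =>
      intro v hv
      rw [map_mul, map_mul]
      exact ha _ (hb v hv)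
    | add a b ha hb =>
      intro v hv
      rw [map_add, map_add]
      exact W.add_mem (ha v hv) (hb v hv)

/-- The coefficient of `e_i v` on the root vector spanning the image of `e_i`. -/
def eFun (r l : K) (i : Node) (v : V4 K) : K := ∑ s, v s * eCoeff r l i s

theorem eOp_eq_eFun (hr : r ≠ 0) (hl : l ≠ 0) (hm : mParam r ≠ 0) (i : Node) (v : V4 K) :
    eOp r l i v = eFun r l i v • bv K i.root := by
  conv_lhs => rw [eq_sum_bv v]
  simp only [map_sum, map_smul, eOp_bv hr hl hm, smul_smul, eFun, Finset.sum_smul]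

theorem eOp_mem {W : Submodule K (V4 K)} (hW : ∀ i, ∀ v ∈ W, gOp r l i v ∈ W) (i : Node)
    {v : V4 K} (hv : v ∈ W) : eOp r l i v ∈ W :=
  W.smul_mem _ (W.sub_mem (W.add_mem (hW i _ (hW i v hv)) (W.smul_mem _ (hW i v hv))) hv)

/-- If an invariant subspace contains one root vector, the operators `e_j` carry it to the root
vectors of the neighbouring nodes, and the `g_j` then produce the whole basis. -/
theorem eq_top_of_root_mem (hr : r ≠ 0) (hl : l ≠ 0) (hm : mParam r ≠ 0)
    {W : Submodule K (V4 K)} (hW : ∀ i, ∀ v ∈ W, gOp r l i v ∈ W) {i : Node}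
    (hi : bv K i.root ∈ W) : W = ⊤ := by
  have he : ∀ j s, eCoeff r l j s = 1 → bv K s ∈ W → bv K j.root ∈ W := by
    intro j s h1 hs
    have := eOp_mem hW j hs
    rwa [eOp_bv hr hl hm, h1, one_smul] at this
  have hg : ∀ j s t, gImage r l j s = bv K t → bv K s ∈ W → bv K t ∈ W := by
    intro j s t h hs
    have := hW j _ hs
    rwa [gOp_bv, h] at this
  have h23 : bv K .w23 ∈ W := by
    cases i
    · exact he .n3 .h12 rfl hi
    · exact he .n3 .w12 rfl hi
    · exact hi
    · exact he .n3 .w34 rfl hi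
  have a12 := he .n2 .w23 rfl h23
  have a34 := he .n4 .w23 rfl h23
  have b12 := he .n1 .w23 rfl h23
  have a13 := hg .n3 .w12 .w13 rfl a12
  have a14 := hg .n4 .w13 .w14 rfl a13
  have a24 := hg .n2 .w14 .w24 rfl a14
  have b13 := hg .n3 .h12 .h13 rfl b12
  have b14 := hg .n4 .h13 .h14 rfl b13
  have b23 := hg .n2 .h13 .h23 rfl b13
  have b24 := hg .n2 .h14 .h24 rfl b14
  have b34 := hg .n3 .h24 .h34 rfl b24
  rw [eq_top_iff]
  intro v _
  rw [eq_sum_bv v]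
  refine W.sum_mem fun s _ => W.smul_mem _ ?_
  cases s <;> assumption

/-- A proper invariant subspace is annihilated by every `e_i`: it is a module over the Hecke
algebra. -/
theorem eFun_eq_zero (hr : r ≠ 0) (hl : l ≠ 0) (hm : mParam r ≠ 0)
    {W : Submodule K (V4 K)} (hW : ∀ i, ∀ v ∈ W, gOp r l i v ∈ W) (htop : W ≠ ⊤) (i : Node)
    {v : V4 K} (hv : v ∈ W) : eFun r l i v = 0 := by
  by_contra h
  refine htop (eq_top_of_root_mem hr hl hm hW (i := i) ?_)
  have := W.smul_mem (eFun r l i v)⁻¹ (eOp_mem hW i hv)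
  rwa [eOp_eq_eFun hr hl hm, smul_smul, inv_mul_cancel₀ h, one_smul] at this

theorem gOp_gOp_of_proper (hr : r ≠ 0) (hl : l ≠ 0) (hm : mParam r ≠ 0)
    {W : Submodule K (V4 K)} (hW : ∀ i, ∀ v ∈ W, gOp r l i v ∈ W) (htop : W ≠ ⊤) (i : Node)
    {v : V4 K} (hv : v ∈ W) : gOp r l i (gOp r l i v) = v - mParam r • gOp r l i v := by
  have h := eOp_eq_eFun hr hl hm i v
  rw [eFun_eq_zero hr hl hm hW htop i hv, zero_smul, eOp, LinearMap.smul_apply,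
    smul_eq_zero_iff_right (mul_ne_zero hl (inv_ne_zero hm))] at h
  simp only [LinearMap.sub_apply, LinearMap.add_apply, LinearMap.smul_apply,
    Module.End.mul_apply, Module.End.one_apply] at h
  rw [eq_sub_iff_add_eq]
  exact sub_eq_zero.mp h

/-! ### Joint eigenvectors of the outer generators -/

/-- The operator `g_i` has the eigenvalues `r` and `-r⁻¹` on a vector satisfying the quadratic
relation; one of the two eigenvectors obtained from it is nonzero. -/
theorem eigenvector_of_quadratic (hr : r ≠ 0) {i : Node} {w : V4 K} (hw : w ≠ 0)
    (hq : gOp r l i (gOp r l i w) = w - mParam r • gOp r l i w) :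
    ∃ a u, (a = r ∨ a = -r⁻¹) ∧ (u = w ∨ u = gOp r l i w - r • w) ∧ u ≠ 0 ∧
      gOp r l i u = a • u := by
  by_cases h : gOp r l i w - r • w = 0
  · exact ⟨r, w, .inl rfl, .inl rfl, hw, sub_eq_zero.mp h⟩
  · refine ⟨-r⁻¹, _, .inr rfl, .inr rfl, h, ?_⟩
    rw [map_sub, map_smul, hq]
    match_scalars
    · field_simp
    · simp only [mParam]
      field_simp
      ring

theorem gOp_gOp_comm (hr : r ≠ 0) (hl : l ≠ 0) {i j : Node} (h : ¬ i.Adj j) (v : V4 K) :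
    gOp r l i (gOp r l j v) = gOp r l j (gOp r l i v) :=
  LinearMap.congr_fun (gOp_comm hr hl i j h) v

/-- If the commuting operators `g_i`, `g_j` differ on `W`, then on the image of `g_i - g_j` one of
them is `r` where the other is `-r⁻¹`; a third operator commuting with both can be diagonalised
there as well. -/
theorem exists_joint_eigenvector (hr : r ≠ 0) (hl : l ≠ 0)
    {W : Submodule K (V4 K)} (hW : ∀ i, ∀ v ∈ W, gOp r l i v ∈ W)
    (hq : ∀ i, ∀ v ∈ W, gOp r l i (gOp r l i v) = v - mParam r • gOp r l i v)
    {i j k : Node} (hij : ¬ i.Adj j) (hik : ¬ i.Adj k) (hjk : ¬ j.Adj k)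
    {x : V4 K} (hx : x ∈ W) (hne : gOp r l i x ≠ gOp r l j x) :
    ∃ a b c : K, ∃ v ∈ W, v ≠ 0 ∧ (a = r ∧ b = -r⁻¹ ∨ a = -r⁻¹ ∧ b = r) ∧
      (c = r ∨ c = -r⁻¹) ∧ gOp r l i v = a • v ∧ gOp r l j v = b • v ∧ gOp r l k v = c • v := by
  obtain ⟨D, hD⟩ : ∃ D, D = gOp r l i x - gOp r l j x := ⟨_, rfl⟩
  have hD0 : D ≠ 0 := hD ▸ sub_ne_zero.mpr hne
  have hDW : D ∈ W := hD ▸ W.sub_mem (hW i x hx) (hW j x hx)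
  have hsum : gOp r l j D = -(mParam r • D) - gOp r l i D := by
    rw [hD, map_sub, map_sub, hq i x hx, hq j x hx, gOp_gOp_comm hr hl hij]
    module
  obtain ⟨a, u, ha, hu, hu0, hau⟩ := eigenvector_of_quadratic hr hD0 (hq i D hDW)
  have huW : u ∈ W := by
    rcases hu with rfl | rfl
    exacts [hDW, W.sub_mem (hW i _ hDW) (W.smul_mem _ hDW)]
  have hju : gOp r l j u = (-(mParam r) - a) • u := by
    have : gOp r l j u = -(mParam r • u) - gOp r l i u := by
      rcases hu with rfl | rfl
      · exact hsum
      · rw [map_sub, map_sub, map_smul, map_smul, ← gOp_gOp_comm hr hl hij, hsum, map_sub,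
          map_neg, map_smul]
        module
    rw [this, hau]
    module
  obtain ⟨c, v, hc, hv, hv0, hcv⟩ := eigenvector_of_quadratic hr hu0 (hq k u huW)
  refine ⟨a, -(mParam r) - a, c, v, ?_, hv0, ?_, hc, ?_, ?_, hcv⟩
  · rcases hv with rfl | rfl
    exacts [huW, W.sub_mem (hW k _ huW) (W.smul_mem _ huW)]
  · rcases ha with rfl | rfl
    · exact .inl ⟨rfl, by simp [mParam]⟩
    · exact .inr ⟨rfl, by simp [mParam]⟩
  · rcases hv with rfl | rfl
    · exact hau
    · rw [map_sub, map_smul, gOp_gOp_comm hr hl hik, hau, map_smul]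
      module
  · rcases hv with rfl | rfl
    · exact hju
    · rw [map_sub, map_smul, gOp_gOp_comm hr hl hjk, hju, map_smul]
      module

/-- If all three outer generators act on `W` as one operator `g`, then `W` is a module over the
Hecke algebra of type `A₂`, and cannot be irreducible of dimension `3`. For an eigenvector `v` of
`g` with eigenvalue `a`, the vector `v + a g₃ v + a² g g₃ v` is a common eigenvector of all
generators; if it vanishes then `v` and `g₃ v` span an invariant subspace. -/
theorem not_outer_eq (hr : r ≠ 0) (hl : l ≠ 0) (hr2 : r ^ 2 ≠ 1)
    {W : Submodule K (V4 K)} (hW : IsIrreducibleInvariant (nu r l hr hl hr2) W)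
    (hdim : Module.finrank K W = 3)
    (hq : ∀ i, ∀ v ∈ W, gOp r l i (gOp r l i v) = v - mParam r • gOp r l i v)
    (h2 : ∀ x ∈ W, gOp r l .n1 x = gOp r l .n2 x) (h4 : ∀ x ∈ W, gOp r l .n1 x = gOp r l .n4 x) :
    False := by
  obtain ⟨hinv, hbot, hirr⟩ := hW
  have hWg := (isInvariant_iff hr hl hr2 W).mp hinv
  obtain ⟨w, hwW, hw0⟩ := W.ne_bot_iff.mp hbot
  obtain ⟨a, v, ha, hv, hv0, hav⟩ := eigenvector_of_quadratic hr hw0 (hq .n1 w hwW)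
  have hvW : v ∈ W := by
    rcases hv with rfl | rfl
    exacts [hwW, W.sub_mem (hWg _ _ hwW) (W.smul_mem _ hwW)]
  have haa : a ^ 2 = 1 - mParam r * a := by
    rcases ha with rfl | rfl <;> simp only [mParam] <;> field_simp <;> ring
  have ha0 : a ≠ 0 := by
    rcases ha with rfl | rfl
    exacts [hr, neg_ne_zero.mpr (inv_ne_zero hr)]
  set y := gOp r l .n3 v with hy
  set z := gOp r l .n1 y with hz
  have hyW : y ∈ W := hWg _ _ hvW
  have hzW : z ∈ W := hWg _ _ hyW
  have h3y : gOp r l .n3 y = v - mParam r • y := hq .n3 v hvW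
  have h1z : gOp r l .n1 z = y - mParam r • z := hq .n1 y hyW
  have h3z : gOp r l .n3 z = a • z := by
    have := LinearMap.congr_fun (gOp_braid hr hl .n3 .n1 ⟨by decide, by decide⟩) v
    simp only [Module.End.mul_apply] at this
    rw [hz, hy, this, hav, map_smul, map_smul]
  -- It suffices to check stability under `g₁` and `g₃`.
  have hstab : ∀ T : Submodule K (V4 K), T ≤ W → (∀ x ∈ T, gOp r l .n1 x ∈ T) →
      (∀ x ∈ T, gOp r l .n3 x ∈ T) → T = ⊥ ∨ T = W := by
    intro T hT hT1 hT3
    refine hirr T hT ((isInvariant_iff hr hl hr2 T).mpr fun i x hx => ?_)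
    cases i
    · exact hT1 x hx
    · rw [← h2 x (hT hx)]; exact hT1 x hx
    · exact hT3 x hx
    · rw [← h4 x (hT hx)]; exact hT1 x hx
  by_cases hx : v + a • y + a ^ 2 • z = 0
  · have hzeq : a ^ 2 • z = -(v + a • y) := by
      rw [← sub_eq_zero, ← hx]; module
    have hz' : z = -((a ^ 2)⁻¹ • v) - a⁻¹ • y := by
      have : z = (a ^ 2)⁻¹ • (a ^ 2 • z) := by
        rw [smul_smul, inv_mul_cancel₀ (pow_ne_zero 2 ha0), one_smul]
      rw [this, hzeq]
      match_scalars <;> field_simp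
    have hvT : v ∈ Submodule.span K {v, y} := Submodule.subset_span (by simp)
    have hyT : y ∈ Submodule.span K {v, y} := Submodule.subset_span (by simp)
    have hTW : Submodule.span K {v, y} ≤ W := by
      rw [Submodule.span_le]
      rintro x (rfl | rfl)
      exacts [hvW, hyW]
    have hmap : ∀ i, gOp r l i v ∈ Submodule.span K {v, y} →
        gOp r l i y ∈ Submodule.span K {v, y} →
        ∀ x ∈ Submodule.span K {v, y}, gOp r l i x ∈ Submodule.span K {v, y} := by
      intro i hiv hiy x hx
      obtain ⟨c, d, rfl⟩ := Submodule.mem_span_pair.mp hx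
      rw [map_add, map_smul, map_smul]
      exact Submodule.add_mem _ (Submodule.smul_mem _ _ hiv) (Submodule.smul_mem _ _ hiy)
    rcases hstab (Submodule.span K {v, y}) hTW
      (hmap .n1 (by rw [hav]; exact Submodule.smul_mem _ _ hvT) (by
        rw [← hz, hz']
        exact Submodule.sub_mem _ (Submodule.neg_mem _ (Submodule.smul_mem _ _ hvT))
          (Submodule.smul_mem _ _ hyT)))
      (hmap .n3 hyT (by
        rw [h3y]
        exact Submodule.sub_mem _ hvT (Submodule.smul_mem _ _ hyT))) with h | h
    · exact hv0 ((Submodule.mem_bot K).mp (h ▸ hvT))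
    · classical
      have := finrank_span_finset_le_card (R := K) ({v, y} : Finset (V4 K))
      rw [Finset.coe_pair, Set.finrank, h, hdim] at this
      exact absurd (this.trans Finset.card_le_two) (by decide)
  · have hxW : v + a • y + a ^ 2 • z ∈ W :=
      W.add_mem (W.add_mem hvW (W.smul_mem _ hyW)) (W.smul_mem _ hzW)
    have h1x : gOp r l .n1 (v + a • y + a ^ 2 • z) = a • (v + a • y + a ^ 2 • z) := by
      rw [map_add, map_add, map_smul, map_smul, hav, ← hz, h1z]
      match_scalars
      · ring
      · linear_combination (-a) * haa
      · ring
    have h3x : gOp r l .n3 (v + a • y + a ^ 2 • z) = a • (v + a • y + a ^ 2 • z) := by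
      rw [map_add, map_add, map_smul, map_smul, ← hy, h3y, h3z]
      match_scalars
      · linear_combination (-1 : K) * haa
      · ring
      · ring
    have hmap : ∀ i, gOp r l i (v + a • y + a ^ 2 • z) = a • (v + a • y + a ^ 2 • z) →
        ∀ x ∈ Submodule.span K {v + a • y + a ^ 2 • z},
          gOp r l i x ∈ Submodule.span K {v + a • y + a ^ 2 • z} := by
      intro i hi x hx
      obtain ⟨c, rfl⟩ := Submodule.mem_span_singleton.mp hx
      rw [map_smul, hi]
      exact Submodule.smul_mem _ _ (Submodule.smul_mem _ _ (Submodule.mem_span_singleton_self _))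
    rcases hstab (Submodule.span K {v + a • y + a ^ 2 • z})
      ((Submodule.span_singleton_le_iff_mem _ _).mpr hxW) (hmap .n1 h1x) (hmap .n3 h3x) with h | h
    · exact hx (Submodule.span_singleton_eq_bot.mp h)
    · rw [← h, finrank_span_singleton hx] at hdim
      omega

theorem ne_top_of_finrank {W : Submodule K (V4 K)} (hdim : Module.finrank K W = 3) : W ≠ ⊤ := by
  rintro rfl
  rw [finrank_top, Module.finrank_fintype_fun_eq_card] at hdim
  exact absurd hdim (by decide)

/-- A three-dimensional irreducible invariant subspace contains a joint eigenvector of the outer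
generators on which they do not all have the same eigenvalue. -/
theorem exists_nonconstant_eigenvector (hr : r ≠ 0) (hl : l ≠ 0) (hr2 : r ^ 2 ≠ 1)
    {W : Submodule K (V4 K)} (hW : IsIrreducibleInvariant (nu r l hr hl hr2) W)
    (hdim : Module.finrank K W = 3) :
    ∃ a b c : K, ∃ v ∈ W, v ≠ 0 ∧ gOp r l .n1 v = a • v ∧ gOp r l .n2 v = b • v ∧
      gOp r l .n4 v = c • v ∧
      (a = r ∧ b = r ∧ c = -r⁻¹ ∨ a = r ∧ b = -r⁻¹ ∧ c = r ∨ a = -r⁻¹ ∧ b = r ∧ c = r ∨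
        a = r ∧ b = -r⁻¹ ∧ c = -r⁻¹ ∨ a = -r⁻¹ ∧ b = r ∧ c = -r⁻¹ ∨
        a = -r⁻¹ ∧ b = -r⁻¹ ∧ c = r) := by
  have hWg := (isInvariant_iff hr hl hr2 W).mp hW.1
  have hq : ∀ i, ∀ v ∈ W, gOp r l i (gOp r l i v) = v - mParam r • gOp r l i v :=
    fun i v hv => gOp_gOp_of_proper hr hl (mParam_ne_zero hr hr2) hWg (ne_top_of_finrank hdim) i hv
  by_cases h2 : ∀ x ∈ W, gOp r l .n1 x = gOp r l .n2 x
  · by_cases h4 : ∀ x ∈ W, gOp r l .n1 x = gOp r l .n4 x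
    · exact (not_outer_eq hr hl hr2 hW hdim hq h2 h4).elim
    · push Not at h4
      obtain ⟨x, hx, hne⟩ := h4
      obtain ⟨a, c, b, v, hv, hv0, hac, hb, h⟩ := exists_joint_eigenvector hr hl hWg hq
        (i := .n1) (j := .n4) (k := .n2) (fun h => absurd h.2 (by decide))
        (fun h => absurd h.2 (by decide)) (fun h => absurd h.2 (by decide)) hx hne
      refine ⟨a, b, c, v, hv, hv0, h.1, h.2.2, h.2.1, ?_⟩
      rcases hac with ⟨rfl, rfl⟩ | ⟨rfl, rfl⟩ <;> rcases hb with rfl | rfl <;> simp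
  · push Not at h2
    obtain ⟨x, hx, hne⟩ := h2
    obtain ⟨a, b, c, v, hv, hv0, hab, hc, h⟩ := exists_joint_eigenvector hr hl hWg hq
      (i := .n1) (j := .n2) (k := .n4) (fun h => absurd h.2 (by decide))
      (fun h => absurd h.2 (by decide)) (fun h => absurd h.2 (by decide)) hx hne
    refine ⟨a, b, c, v, hv, hv0, h.1, h.2.1, h.2.2, ?_⟩
    rcases hab with ⟨rfl, rfl⟩ | ⟨rfl, rfl⟩ <;> rcases hc with rfl | rfl <;> simp

/-! ### Modules of reduced Burau type -/

/-- A deformation of the Cartan matrix of type `A₃`, up to sign. On the modules below `g_k - r` maps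
the `j`-th basis vector to the `(i, j)` entry times the `i`-th basis vector, where `i` depends on
`k` only. The off-diagonal entries are parameters, so that the basis need not be rescaled. -/
def chainMatrix (r α β γ ε : K) : Matrix (Fin 3) (Fin 3) K :=
  !![-(r + r⁻¹), α, 0; β, -(r + r⁻¹), γ; 0, ε, -(r + r⁻¹)]

theorem eq_zero_of_chainMatrix_mulVec (hr : r ≠ 0) (hr2 : r ^ 2 ≠ -1) (hr4 : r ^ 4 ≠ -1)
    {α β γ ε : K} (hαβ : α * β = 1) (hγε : γ * ε = 1) {a : Fin 3 → K}
    (h : ∀ i, ∑ j, a j * chainMatrix r α β γ ε i j = 0) : a = 0 := by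
  obtain ⟨x, hx⟩ : ∃ x, x = a 0 := ⟨_, rfl⟩
  obtain ⟨y, hy⟩ : ∃ y, y = a 1 := ⟨_, rfl⟩
  obtain ⟨z, hz⟩ : ∃ z, z = a 2 := ⟨_, rfl⟩
  have h0 : x * -(r + r⁻¹) + y * α + z * 0 = 0 := by
    have := h 0
    rw [Fin.sum_univ_three, ← hx, ← hy, ← hz] at this
    exact this
  have h1 : x * β + y * -(r + r⁻¹) + z * γ = 0 := by
    have := h 1
    rw [Fin.sum_univ_three, ← hx, ← hy, ← hz] at this
    exact this
  have h2 : x * 0 + y * ε + z * -(r + r⁻¹) = 0 := by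
    have := h 2
    rw [Fin.sum_univ_three, ← hx, ← hy, ← hz] at this
    exact this
  have hs : r + r⁻¹ ≠ 0 := by
    intro hs
    apply hr2
    field_simp at hs
    linear_combination hs
  have y0 : y = 0 := by
    have h4 : (r ^ 4 + 1) * y = 0 := by
      have h5 : (2 - (r + r⁻¹) ^ 2) * y = 0 := by
        linear_combination (r + r⁻¹) * h1 + β * h0 + γ * h2 - y * hαβ - y * hγε
      field_simp at h5
      linear_combination (-1 : K) * h5
    exact (mul_eq_zero.mp h4).resolve_left fun h => hr4 (eq_neg_of_add_eq_zero_left h)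
  rw [y0] at h0 h2
  have x0 : x = 0 := by
    refine (mul_eq_zero.mp (?_ : x * (r + r⁻¹) = 0)).resolve_right hs
    linear_combination (-1 : K) * h0
  have z0 : z = 0 := by
    refine (mul_eq_zero.mp (?_ : z * (r + r⁻¹) = 0)).resolve_right hs
    linear_combination (-1 : K) * h2
  ext i
  fin_cases i
  exacts [hx ▸ x0, hy ▸ y0, hz ▸ z0]

/-- Three nonzero vectors on which the generators act through `chainMatrix`, as in the reduced Burau
representation, span an irreducible invariant subspace of dimension `3`. Here `κ k` is the index of
the vector spanning the image of `g_k - r`. The matrix is invertible, so a nonzero vector of an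
invariant subspace yields one of the three vectors, and its nonzero off-diagonal entries yield the
others. -/
theorem irreducible_of_chain (hr : r ≠ 0) (hl : l ≠ 0) (hr2 : r ^ 2 ≠ 1) (hr2' : r ^ 2 ≠ -1)
    (hr4 : r ^ 4 ≠ -1) {α β γ ε : K} (hαβ : α * β = 1) (hγε : γ * ε = 1) {p : Fin 3 → V4 K}
    (hp : ∀ j, p j ≠ 0) {κ : Node → Fin 3} (hκ : Function.Surjective κ)
    (hact : ∀ k j, gOp r l k (p j) = r • p j + chainMatrix r α β γ ε (κ k) j • p (κ k)) :
    IsIrreducibleInvariant (nu r l hr hl hr2) (Submodule.span K (Set.range p)) ∧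
      Module.finrank K (Submodule.span K (Set.range p)) = 3 := by
  have hsum : ∀ k (a : Fin 3 → K), gOp r l k (∑ j, a j • p j) - r • (∑ j, a j • p j) =
      (∑ j, a j * chainMatrix r α β γ ε (κ k) j) • p (κ k) := by
    intro k a
    simp only [map_sum, map_smul, hact, Finset.sum_smul, Finset.smul_sum, mul_smul]
    rw [← Finset.sum_sub_distrib]
    refine Finset.sum_congr rfl fun j _ => ?_
    module
  have hli : LinearIndependent K p := by
    rw [Fintype.linearIndependent_iff]
    intro a ha
    refine congrFun (eq_zero_of_chainMatrix_mulVec hr hr2' hr4 hαβ hγε fun i => ?_)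
    obtain ⟨k, rfl⟩ := hκ i
    have := hsum k a
    rw [ha, map_zero, smul_zero, sub_zero] at this
    exact (smul_eq_zero.mp this.symm).resolve_right (hp _)
  have hfr : Module.finrank K (Submodule.span K (Set.range p)) = 3 := by
    rw [finrank_span_eq_card hli, Fintype.card_fin]
  have hmem : ∀ j, p j ∈ Submodule.span K (Set.range p) := fun j =>
    Submodule.subset_span ⟨j, rfl⟩
  refine ⟨⟨?_, ?_, ?_⟩, hfr⟩
  · rw [isInvariant_iff]
    intro k v hv
    obtain ⟨a, rfl⟩ := (Submodule.mem_span_range_iff_exists_fun K).mp hv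
    rw [← sub_add_cancel (gOp r l k _) (r • ∑ j, a j • p j), hsum]
    exact Submodule.add_mem _ (Submodule.smul_mem _ _ (hmem _)) (Submodule.smul_mem _ _ hv)
  · exact (Submodule.ne_bot_iff _).mpr ⟨p 0, hmem 0, hp 0⟩
  · intro T hT hTinv
    rw [isInvariant_iff] at hTinv
    by_cases hbot : T = ⊥
    · exact .inl hbot
    refine .inr (le_antisymm hT ?_)
    obtain ⟨x, hxT, hx0⟩ := T.ne_bot_iff.mp hbot
    obtain ⟨a, rfl⟩ := (Submodule.mem_span_range_iff_exists_fun K).mp (hT hxT)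
    have key : ∀ (b : Fin 3 → K) i, ∑ j, b j • p j ∈ T →
        ∑ j, b j * chainMatrix r α β γ ε i j ≠ 0 → p i ∈ T := by
      intro b i hb hne
      obtain ⟨k, rfl⟩ := hκ i
      have := T.sub_mem (hTinv k _ hb) (T.smul_mem r hb)
      rw [hsum] at this
      exact (T.smul_mem_iff hne).mp this
    have spread : ∀ j i, chainMatrix r α β γ ε i j ≠ 0 → p j ∈ T → p i ∈ T := by
      intro j i hne hj
      refine key (Pi.single j 1) i ?_ ?_
      · simpa [Pi.single_apply] using hj
      · simpa [Pi.single_apply] using hne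
    obtain ⟨i, hi⟩ : ∃ i, p i ∈ T := by
      by_contra! hcon
      apply hx0
      rw [eq_zero_of_chainMatrix_mulVec hr hr2' hr4 hαβ hγε (a := a) fun i => ?_]
      · simp
      · by_contra hne
        exact hcon i (key a i hxT hne)
    have hα := left_ne_zero_of_mul_eq_one hαβ
    have hβ := right_ne_zero_of_mul_eq_one hαβ
    have hγ := left_ne_zero_of_mul_eq_one hγε
    have hε := right_ne_zero_of_mul_eq_one hγε
    have h1 : p 1 ∈ T := by
      fin_cases i
      · exact spread 0 1 (by simpa [chainMatrix] using hβ) hi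
      · exact hi
      · exact spread 2 1 (by simpa [chainMatrix] using hγ) hi
    rw [Submodule.span_le, Set.range_subset_iff]
    intro j
    fin_cases j
    · exact spread 1 0 (by simpa [chainMatrix] using hα) h1
    · exact h1
    · exact spread 1 2 (by simpa [chainMatrix] using hε) h1

/-! ### Vectors in a three-dimensional subspace -/

/-- All `4 × 4` minors of four vectors in a three-dimensional subspace vanish. -/
theorem minor_eq_zero {W : Submodule K (V4 K)} (hdim : Module.finrank K W = 3)
    {x : Fin 4 → V4 K} (hx : ∀ i, x i ∈ W) (σ : Fin 4 → Idx) :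
    (Matrix.of fun i j => x i (σ j)).det = 0 := by
  by_contra h
  have h1 := Matrix.linearIndependent_rows_of_det_ne_zero h
  have h2 : LinearIndependent K fun i => (⟨x i, hx i⟩ : W) := by
    refine LinearIndependent.of_comp ((LinearMap.funLeft K K σ).comp W.subtype) ?_
    exact h1
  have := h2.fintype_card_le_finrank
  rw [hdim, Fintype.card_fin] at this
  omega

/-! ### Explicit joint eigenvectors -/

/-- The vector whose coordinates on `w₁₃, w₁₄, w₂₃, w₂₄` and their hatted companions are those of
a joint eigenvector of `g₁, g₂, g₄` with eigenvalues `a, b, c`, normalised at `w₁₃`, and whose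
coordinates on `w₁₂, w₃₄, ŵ₁₂` are `p, q, s`. -/
def orbitVec (a b c p q s : K) (t : Idx) : K :=
  match t with
  | .w12 => p
  | .w13 => 1
  | .w14 => c
  | .w23 => b
  | .w24 => b * c
  | .w34 => q
  | .h12 => s
  | .h13 => a⁻¹ * b⁻¹
  | .h14 => a⁻¹ * b⁻¹ * c
  | .h23 => a⁻¹
  | .h24 => a⁻¹ * c
  | .h34 => 0

/-- The coordinates of a joint eigenvector outside `w₁₂, w₃₄, ŵ₁₂`, once its `ŵ₃₄`-coordinate is
known to vanish. -/
theorem orbit_coords {a b c : K} (ha : a ≠ 0) (hb : b ≠ 0) {v : V4 K}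
    (h1 : gCoord r l .n1 v = a • v) (h2 : gCoord r l .n2 v = b • v)
    (h4 : gCoord r l .n4 v = c • v) (h34 : v .h34 = 0) :
    v .w14 = v .w13 * c ∧ v .w23 = v .w13 * b ∧ v .w24 = v .w13 * (b * c) ∧
      v .h13 = v .w13 * (a⁻¹ * b⁻¹) ∧ v .h14 = v .w13 * (a⁻¹ * b⁻¹ * c) ∧
      v .h23 = v .w13 * a⁻¹ ∧ v .h24 = v .w13 * (a⁻¹ * c) := by
  have e23 : v .w23 = b * v .w13 := congrFun h2 .w13
  have e14 : v .w14 = c * v .w13 := congrFun h4 .w13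
  have e24 : v .w24 = b * v .w14 := congrFun h2 .w14
  have f23 : v .h23 = b * v .h13 := congrFun h2 .h13
  have f24 : v .h24 = b * v .h14 := congrFun h2 .h14
  have f14 : v .h14 = c * v .h13 := congrFun h4 .h13
  have g23 : v .w13 + mParam r * v .h34 = a * v .h23 := congrFun h1 .h23
  rw [h34, mul_zero, add_zero] at g23
  have k23 : v .h23 = v .w13 * a⁻¹ := by
    rw [g23]; field_simp
  have k13 : v .h13 = v .w13 * (a⁻¹ * b⁻¹) := by
    rw [f23] at k23
    field_simp at k23 ⊢
    linear_combination k23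
  refine ⟨?_, ?_, ?_, k13, ?_, k23, ?_⟩
  · rw [e14]; ring
  · rw [e23]; ring
  · rw [e24, e14]; ring
  · rw [f14, k13]; ring
  · rw [f24, f14, k13]; field_simp

theorem h34_eq_zero (hs : r ≠ -r⁻¹) {i : Node} (hi : i ≠ .n3) {v : V4 K}
    (h : gCoord r l i v = (-r⁻¹) • v) : v .h34 = 0 := by
  have h' : r * v .h34 = -r⁻¹ * v .h34 := by
    cases i
    · exact congrFun h .h34
    · exact congrFun h .h34
    · exact absurd rfl hi
    · exact congrFun h .h34
  by_contra hne
  exact hs (mul_right_cancel₀ hne h')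

theorem eFun_n3 (v : V4 K) :
    eFun r l .n3 v = v .w12 + v .w13 * l⁻¹ + v .w23 * (1 - (l - l⁻¹) * (mParam r)⁻¹)
      + v .w24 * l + v .w34 + v .h12 + v .h13 * l⁻¹ + v .h24 * r⁻¹ + v .h34 * (r⁻¹ * l⁻¹) := by
  rw [eFun, sum_idx]
  simp only [eCoeff]
  ring

/-- A joint eigenvector of the outer generators annihilated by `e₃` is a multiple of one of six
explicit vectors, unless the three eigenvalues agree. -/
theorem eq_smul_orbitVec (hr : r ≠ 0) (hr2 : r ^ 2 ≠ -1) {a b c : K} {v : V4 K} (hv : v ≠ 0)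
    (h1 : gOp r l .n1 v = a • v) (h2 : gOp r l .n2 v = b • v) (h4 : gOp r l .n4 v = c • v)
    (h3 : eFun r l .n3 v = 0)
    (hpat : a = r ∧ b = r ∧ c = -r⁻¹ ∨ a = r ∧ b = -r⁻¹ ∧ c = r ∨ a = -r⁻¹ ∧ b = r ∧ c = r ∨
        a = r ∧ b = -r⁻¹ ∧ c = -r⁻¹ ∨ a = -r⁻¹ ∧ b = r ∧ c = -r⁻¹ ∨
        a = -r⁻¹ ∧ b = -r⁻¹ ∧ c = r) :
    ∃ t β : K, t ≠ 0 ∧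
      (v = t • orbitVec r r (-r⁻¹) 0 β 0 ∨ v = t • orbitVec r (-r⁻¹) r β 0 0 ∨
        v = t • orbitVec (-r⁻¹) r r (r⁻¹ - r ^ 3) 0 β ∨ v = t • orbitVec r (-r⁻¹) (-r⁻¹) 0 0 0 ∨
        v = t • orbitVec (-r⁻¹) r (-r⁻¹) 0 0 0 ∨
        v = t • orbitVec (-r⁻¹) (-r⁻¹) r (r⁻¹ - r ^ 3) 0 0) := by
  rw [gOp_eq_gCoord] at h1 h2 h4
  have hs : r ≠ -r⁻¹ := by
    intro hs
    apply hr2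
    field_simp at hs
    exact hs
  have hmi : -r⁻¹ ≠ 0 := neg_ne_zero.mpr (inv_ne_zero hr)
  have h34 : v .h34 = 0 := by
    rcases hpat with ⟨rfl, rfl, rfl⟩ | ⟨rfl, rfl, rfl⟩ | ⟨rfl, rfl, rfl⟩ | ⟨rfl, rfl, rfl⟩ |
      ⟨rfl, rfl, rfl⟩ | ⟨rfl, rfl, rfl⟩
    exacts [h34_eq_zero hs (by decide) h4, h34_eq_zero hs (by decide) h2,
      h34_eq_zero hs (by decide) h1, h34_eq_zero hs (by decide) h2,
      h34_eq_zero hs (by decide) h1, h34_eq_zero hs (by decide) h1]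
  have ha : a ≠ 0 := by
    rcases hpat with h | h | h | h | h | h <;> rw [h.1] <;> assumption
  have hb : b ≠ 0 := by
    rcases hpat with h | h | h | h | h | h <;> rw [h.2.1] <;> assumption
  obtain ⟨k14, k23, k24, l13, l14, l23, l24⟩ := orbit_coords ha hb h1 h2 h4 h34
  have hz : ∀ x, r * x = -r⁻¹ * x → x = 0 := fun x hx => by
    by_contra hne
    exact hs (mul_right_cancel₀ hne hx)
  -- The coordinates on `w₁₂, w₃₄, ŵ₁₂` vanish where two generators have different eigenvalues.
  have p4 : r * v .w12 = c * v .w12 := congrFun h4 .w12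
  have q1 : r * v .w34 = a * v .w34 := congrFun h1 .w34
  have q2 : r * v .w34 = b * v .w34 := congrFun h2 .w34
  have s2 : r * v .h12 = b * v .h12 := congrFun h2 .h12
  have s4 : r * v .h12 = c * v .h12 := congrFun h4 .h12
  have p1 := congrFun h1 .w12
  simp only [gCoord, Pi.smul_apply, smul_eq_mul] at p1
  rw [l23, l24, k14, h34] at p1
  have p1' : (a - r) * v .w12 = v .w13 * (mParam r * a⁻¹ + mParam r * r * (a⁻¹ * c)
      - mParam r * r⁻¹ - mParam r * c) := by
    linear_combination (-1 : K) * p1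
  have hp1 : a = -r⁻¹ → c = r → v .w12 = v .w13 * (r⁻¹ - r ^ 3) := by
    rintro rfl rfl
    have hs' : -c⁻¹ - c ≠ 0 := fun h => hs (sub_eq_zero.mp h).symm
    refine mul_left_cancel₀ hs' (p1'.trans ?_)
    simp only [mParam]
    field_simp
    ring
  rw [eFun_n3, k23, k24, l13, l24, h34] at h3
  have ht : v .w13 ≠ 0 := by
    intro ht
    simp only [ht, zero_mul, add_zero] at k14 k23 k24 l13 l14 l23 l24 h3 hp1
    apply hv
    have hall : v .w12 = 0 ∧ v .w34 = 0 ∧ v .h12 = 0 := by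
      rcases hpat with ⟨rfl, rfl, rfl⟩ | ⟨rfl, rfl, rfl⟩ | ⟨rfl, rfl, rfl⟩ | ⟨rfl, rfl, rfl⟩ |
        ⟨rfl, rfl, rfl⟩ | ⟨rfl, rfl, rfl⟩
      · rw [hz _ p4, hz _ s4] at h3
        exact ⟨hz _ p4, by simpa using h3, hz _ s4⟩
      · rw [hz _ q2, hz _ s2] at h3
        exact ⟨by simpa using h3, hz _ q2, hz _ s2⟩
      · rw [hz _ q1, hp1 rfl rfl] at h3
        exact ⟨hp1 rfl rfl, hz _ q1, by simpa using h3⟩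
      · exact ⟨hz _ p4, hz _ q2, hz _ s2⟩
      · exact ⟨hz _ p4, hz _ q1, hz _ s4⟩
      · exact ⟨hp1 rfl rfl, hz _ q1, hz _ s2⟩
    ext t
    cases t
    exacts [hall.1, ht, k14, k23, k24, hall.2.1, hall.2.2, l13, l14, l23, l24, h34]
  have hext : ∀ p q s, v .w12 = v .w13 * p → v .w34 = v .w13 * q → v .h12 = v .w13 * s →
      v = v .w13 • orbitVec a b c p q s := by
    intro p q s hp hq hs
    ext t
    cases t <;> simp only [Pi.smul_apply, smul_eq_mul, orbitVec, mul_one, mul_zero] <;> assumption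
  rcases hpat with ⟨rfl, rfl, rfl⟩ | ⟨rfl, rfl, rfl⟩ | ⟨rfl, rfl, rfl⟩ | ⟨rfl, rfl, rfl⟩ |
    ⟨rfl, rfl, rfl⟩ | ⟨rfl, rfl, rfl⟩
  · refine ⟨v .w13, v .w34 / v .w13, ht, .inl (hext _ _ _ ?_ ?_ ?_)⟩
    exacts [by rw [hz _ p4, mul_zero], by field_simp, by rw [hz _ s4, mul_zero]]
  · refine ⟨v .w13, v .w12 / v .w13, ht, .inr (.inl (hext _ _ _ ?_ ?_ ?_))⟩
    exacts [by field_simp, by rw [hz _ q2, mul_zero], by rw [hz _ s2, mul_zero]]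
  · refine ⟨v .w13, v .h12 / v .w13, ht, .inr (.inr (.inl (hext _ _ _ ?_ ?_ ?_)))⟩
    exacts [hp1 rfl rfl, by rw [hz _ q1, mul_zero], by field_simp]
  · refine ⟨v .w13, 0, ht, .inr (.inr (.inr (.inl (hext _ _ _ ?_ ?_ ?_))))⟩
    exacts [by rw [hz _ p4, mul_zero], by rw [hz _ q2, mul_zero], by rw [hz _ s2, mul_zero]]
  · refine ⟨v .w13, 0, ht, .inr (.inr (.inr (.inr (.inl (hext _ _ _ ?_ ?_ ?_)))))⟩
    exacts [by rw [hz _ p4, mul_zero], by rw [hz _ q1, mul_zero], by rw [hz _ s4, mul_zero]]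
  · refine ⟨v .w13, 0, ht, .inr (.inr (.inr (.inr (.inr (hext _ _ _ ?_ ?_ ?_)))))⟩
    exacts [hp1 rfl rfl, by rw [hz _ q1, mul_zero], by rw [hz _ s2, mul_zero]]

/-! ### Reducibility forces `l = 1/r` -/

theorem det_four (x y z w : V4 K) (a b c d : Idx) :
    (Matrix.of fun i j => (![x, y, z, w] : Fin 4 → V4 K) i ((![a, b, c, d] : Fin 4 → Idx) j)).det =
      (x a * y b - x b * y a) * (z c * w d - z d * w c)
      - (x a * y c - x c * y a) * (z b * w d - z d * w b)
      + (x a * y d - x d * y a) * (z b * w c - z c * w b)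
      + (x b * y c - x c * y b) * (z a * w d - z d * w a)
      - (x b * y d - x d * y b) * (z a * w c - z c * w a)
      + (x c * y d - x d * y c) * (z a * w b - z b * w a) := by
  rw [Matrix.det_succ_row_zero]
  simp [Fin.sum_univ_succ, Matrix.det_fin_three, Fin.succAbove]
  ring

/-- The vectors `x, g₃ x, g_i g₃ x, g_j g₃ x` in a three-dimensional invariant subspace have
vanishing minors. -/
theorem minor_orbit {W : Submodule K (V4 K)} (hdim : Module.finrank K W = 3)
    (hW : ∀ i, ∀ v ∈ W, gOp r l i v ∈ W) (i j : Node) {x : V4 K} (hx : x ∈ W) (a b c d : Idx) :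
    let y := gCoord r l .n3 x
    let z := gCoord r l i y
    let w := gCoord r l j y
    (x a * y b - x b * y a) * (z c * w d - z d * w c)
      - (x a * y c - x c * y a) * (z b * w d - z d * w b)
      + (x a * y d - x d * y a) * (z b * w c - z c * w b)
      + (x b * y c - x c * y b) * (z a * w d - z d * w a)
      - (x b * y d - x d * y b) * (z a * w c - z c * w a)
      + (x c * y d - x d * y c) * (z a * w b - z b * w a) = 0 := by
  intro y z w
  have hmem : ∀ k, ∀ u ∈ W, gCoord r l k u ∈ W := fun k u hu => gOp_eq_gCoord k u ▸ hW k u hu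
  have hy : y ∈ W := hmem _ _ hx
  rw [← det_four]
  refine minor_eq_zero hdim (fun k => ?_) _
  fin_cases k
  exacts [hx, hy, hmem _ _ hy, hmem _ _ hy]

/-- If a three-dimensional invariant subspace contains one of the six joint eigenvectors, then
`l = 1/r`: each of the minors below is a unit times `(l r - 1) ^ 2` or `(l r - 1) β`, or, for
`β = 0`, a unit times `(r ^ 4 - 1) ^ 2`. -/
theorem eq_one_div_of_orbitVec_mem (hr : r ≠ 0) (hl : l ≠ 0) (hr4 : r ^ 4 ≠ 1)
    {W : Submodule K (V4 K)} (hdim : Module.finrank K W = 3)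
    (hW : ∀ i, ∀ v ∈ W, gOp r l i v ∈ W) {β : K}
    (h : orbitVec r r (-r⁻¹) 0 β 0 ∈ W ∨ orbitVec r (-r⁻¹) r β 0 0 ∈ W ∨
      orbitVec (-r⁻¹) r r (r⁻¹ - r ^ 3) 0 β ∈ W ∨ orbitVec r (-r⁻¹) (-r⁻¹) 0 0 0 ∈ W ∨
      orbitVec (-r⁻¹) r (-r⁻¹) 0 0 0 ∈ W ∨
      orbitVec (-r⁻¹) (-r⁻¹) r (r⁻¹ - r ^ 3) 0 0 ∈ W) : l = 1 / r := by
  suffices hs : l * r - 1 = 0 by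
    rw [eq_div_iff hr]
    exact sub_eq_zero.mp hs
  have hsq : ∀ n : ℕ, r ^ n * (l * r - 1) ^ 2 = 0 → l * r - 1 = 0 := fun n hn =>
    pow_eq_zero_iff two_ne_zero |>.mp ((mul_eq_zero.mp hn).resolve_left (pow_ne_zero n hr))
  have hβ : ∀ n : ℕ, β ≠ 0 → r ^ n * β * (l * r - 1) = 0 → l * r - 1 = 0 := fun n hb hn =>
    (mul_eq_zero.mp hn).resolve_left (mul_ne_zero (pow_ne_zero n hr) hb)
  have h4 : ∀ n : ℕ, r ^ n * l * (r ^ 4 - 1) ^ 2 ≠ 0 := fun n =>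
    mul_ne_zero (mul_ne_zero (pow_ne_zero n hr) hl) (pow_ne_zero 2 (sub_ne_zero.mpr hr4))
  have minor := @minor_orbit K _ r l W hdim hW
  rcases h with h | h | h | h | h | h
  · by_cases hb : β = 0
    · subst hb
      have := minor .n1 .n2 h .w12 .w14 .w34 .h23
      simp only [gCoord, orbitVec, mParam] at this
      field_simp at this
      exact absurd (by linear_combination (-1 : K) * this) (h4 1)
    · have := minor .n1 .n2 h .w13 .w14 .w24 .h24
      simp only [gCoord, orbitVec, mParam] at this
      field_simp at this
      exact hβ 0 hb (by linear_combination this)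
  · by_cases hb : β = 0
    · subst hb
      have := minor .n1 .n2 h .w12 .w13 .w24 .h12
      simp only [gCoord, orbitVec, mParam] at this
      field_simp at this
      exact hsq 7 (by linear_combination this)
    · have := minor .n1 .n4 h .w12 .w14 .w34 .h34
      simp only [gCoord, orbitVec, mParam] at this
      field_simp at this
      exact hβ 7 hb (by linear_combination (-1 : K) * this)
  · by_cases hb : β = 0
    · subst hb
      have := minor .n2 .n4 h .w12 .w14 .h12 .h23
      simp only [gCoord, orbitVec, mParam] at this
      field_simp at this
      exact absurd (by linear_combination this) (h4 4)
    · have := minor .n2 .n4 h .w12 .w13 .h12 .h24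
      simp only [gCoord, orbitVec, mParam] at this
      field_simp at this
      exact hβ 10 hb (by linear_combination this)
  · have := minor .n1 .n2 h .w12 .w14 .w24 .h13
    simp only [gCoord, orbitVec, mParam] at this
    field_simp at this
    exact hsq 6 (by linear_combination this)
  · have := minor .n1 .n2 h .w12 .w13 .w23 .w24
    simp only [gCoord, orbitVec, mParam] at this
    field_simp at this
    exact hsq 7 (by linear_combination this)
  · have := minor .n1 .n2 h .w12 .w14 .w23 .w24
    simp only [gCoord, orbitVec, mParam] at this
    field_simp at this
    exact hsq 15 (by linear_combination this)

/-! ### The three subspaces for `l = 1/r` -/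

/-- A basis of the span of `u₁, u₂, u₃` adapted to `irreducible_of_chain`. -/
def uChain (r : K) : Fin 3 → V4 K :=
  ![uVec r 0 - r⁻¹ • uVec r 1, -(r⁻¹ • uVec r 0) + (r⁻¹) ^ 2 • uVec r 2,
    uVec r 0 + r • uVec r 1]

/-- A basis of the span of `w₁, w₂, w₃` adapted to `irreducible_of_chain`. -/
def wChain (r : K) : Fin 3 → V4 K :=
  ![-wVec r 0 - r⁻¹ • wVec r 2, r • wVec r 0 - wVec r 1, -wVec r 0 + r • wVec r 2]

/-- On the span of the `u_i` the generators `g₂` and `g₄` agree. -/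
def uNode : Node → Fin 3
  | .n1 => 2
  | .n2 => 0
  | .n3 => 1
  | .n4 => 0

/-- On the span of the `w_i` the generators `g₁` and `g₄` agree. -/
def wNode : Node → Fin 3
  | .n1 => 0
  | .n2 => 2
  | .n3 => 1
  | .n4 => 0

/-- On the span of the `v_i` the generators `g₁` and `g₂` agree. -/
def vNode : Node → Fin 3
  | .n1 => 0
  | .n2 => 0
  | .n3 => 1
  | .n4 => 2

theorem gOp_uChain (hr : r ≠ 0) (k : Node) (j : Fin 3) :
    gOp r (1 / r) k (uChain r j) = r • uChain r j +
      chainMatrix r 1 1 (r ^ 4) ((r ^ 4)⁻¹) (uNode k) j • uChain r (uNode k) := by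
  cases k <;> fin_cases j <;>
    simp [uChain, uVec, uNode, chainMatrix, gOp_bv, gImage] <;>
    match_scalars <;> (try simp only [mParam]) <;> (try field_simp) <;> (try ring)

theorem gOp_wChain (hr : r ≠ 0) (k : Node) (j : Fin 3) :
    gOp r (1 / r) k (wChain r j) = r • wChain r j +
      chainMatrix r 1 1 1 1 (wNode k) j • wChain r (wNode k) := by
  cases k <;> fin_cases j <;>
    simp [wChain, wVec, wNode, chainMatrix, gOp_bv, gImage] <;>
    match_scalars <;> (try simp only [mParam]) <;> (try field_simp) <;> (try ring)

theorem gOp_vVec (hr : r ≠ 0) (k : Node) (j : Fin 3) :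
    gOp r (1 / r) k (vVec r j) = r • vVec r j +
      chainMatrix r r⁻¹ r r⁻¹ r (vNode k) j • vVec r (vNode k) := by
  cases k <;> fin_cases j <;>
    simp [vVec, vNode, chainMatrix, gOp_bv, gImage] <;>
    match_scalars <;> (try simp only [mParam]) <;> (try field_simp) <;> (try ring)

theorem uChain_ne_zero (hr : r ≠ 0) (j : Fin 3) : uChain r j ≠ 0 := by
  intro h
  fin_cases j
  · simpa [uChain, uVec, bv, Pi.single_apply] using congrFun h .w13
  · simpa [uChain, uVec, bv, Pi.single_apply, hr] using congrFun h .w13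
  · simpa [uChain, uVec, bv, Pi.single_apply] using congrFun h .w13

theorem wChain_ne_zero (j : Fin 3) : wChain r j ≠ 0 := by
  intro h
  fin_cases j
  · simpa [wChain, wVec, bv, Pi.single_apply] using congrFun h .w13
  · simpa [wChain, wVec, bv, Pi.single_apply] using congrFun h .w12
  · simpa [wChain, wVec, bv, Pi.single_apply] using congrFun h .w13

theorem vVec_ne_zero (j : Fin 3) : vVec r j ≠ 0 := by
  intro h
  fin_cases j
  · simpa [vVec, bv, Pi.single_apply] using congrFun h .w13
  · simpa [vVec, bv, Pi.single_apply] using congrFun h .w24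
  · simpa [vVec, bv, Pi.single_apply] using congrFun h .h13

/-- Three vectors whose span contains a three-dimensional span generate the same subspace. -/
theorem span_eq_of_mem {p q : Fin 3 → V4 K} (h : ∀ j, p j ∈ Submodule.span K (Set.range q))
    (hp : Module.finrank K (Submodule.span K (Set.range p)) = 3) :
    Submodule.span K (Set.range p) = Submodule.span K (Set.range q) := by
  refine Submodule.eq_of_le_of_finrank_le (Submodule.span_le.mpr ?_) ?_
  · rintro _ ⟨j, rfl⟩
    exact h j
  · rw [hp]
    exact (finrank_range_le_card q).trans (by simp)

theorem uChain_mem (r : K) (j : Fin 3) :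
    uChain r j ∈ Submodule.span K (Set.range (uVec r)) := by
  have h : ∀ i, uVec r i ∈ Submodule.span K (Set.range (uVec r)) := fun i =>
    Submodule.subset_span ⟨i, rfl⟩
  fin_cases j
  · exact Submodule.sub_mem _ (h 0) (Submodule.smul_mem _ _ (h 1))
  · exact Submodule.add_mem _ (Submodule.neg_mem _ (Submodule.smul_mem _ _ (h 0)))
      (Submodule.smul_mem _ _ (h 2))
  · exact Submodule.add_mem _ (h 0) (Submodule.smul_mem _ _ (h 1))

theorem wChain_mem (r : K) (j : Fin 3) :
    wChain r j ∈ Submodule.span K (Set.range (wVec r)) := by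
  have h : ∀ i, wVec r i ∈ Submodule.span K (Set.range (wVec r)) := fun i =>
    Submodule.subset_span ⟨i, rfl⟩
  fin_cases j
  · exact Submodule.sub_mem _ (Submodule.neg_mem _ (h 0)) (Submodule.smul_mem _ _ (h 2))
  · exact Submodule.sub_mem _ (Submodule.smul_mem _ _ (h 0)) (h 1)
  · exact Submodule.add_mem _ (Submodule.neg_mem _ (h 0)) (Submodule.smul_mem _ _ (h 2))

theorem irreducible_uVec (hr : r ≠ 0) (hl : 1 / r ≠ 0) (hr2 : r ^ 2 ≠ 1) (hr2' : r ^ 2 ≠ -1)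
    (hr4 : r ^ 4 ≠ -1) :
    IsIrreducibleInvariant (nu r (1 / r) hr hl hr2) (Submodule.span K (Set.range (uVec r))) ∧
      Module.finrank K (Submodule.span K (Set.range (uVec r))) = 3 := by
  have h := irreducible_of_chain hr hl hr2 hr2' hr4 (mul_one 1)
    (mul_inv_cancel₀ (pow_ne_zero 4 hr)) (uChain_ne_zero hr) (κ := uNode)
    (fun i => by fin_cases i; exacts [⟨.n2, rfl⟩, ⟨.n3, rfl⟩, ⟨.n1, rfl⟩]) (gOp_uChain hr)
  rwa [span_eq_of_mem (uChain_mem r) h.2] at h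

theorem irreducible_wChain (hr : r ≠ 0) (hl : 1 / r ≠ 0) (hr2 : r ^ 2 ≠ 1) (hr2' : r ^ 2 ≠ -1)
    (hr4 : r ^ 4 ≠ -1) :
    IsIrreducibleInvariant (nu r (1 / r) hr hl hr2) (Submodule.span K (Set.range (wChain r))) ∧
      Module.finrank K (Submodule.span K (Set.range (wChain r))) = 3 :=
  irreducible_of_chain hr hl hr2 hr2' hr4 (mul_one 1) (mul_one 1) wChain_ne_zero
    (κ := wNode) (fun i => by fin_cases i; exacts [⟨.n1, rfl⟩, ⟨.n3, rfl⟩, ⟨.n2, rfl⟩])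
    (gOp_wChain hr)

theorem span_wChain (hr : r ≠ 0) (hl : 1 / r ≠ 0) (hr2 : r ^ 2 ≠ 1) (hr2' : r ^ 2 ≠ -1)
    (hr4 : r ^ 4 ≠ -1) :
    Submodule.span K (Set.range (wChain r)) = Submodule.span K (Set.range (wVec r)) :=
  span_eq_of_mem (wChain_mem r) (irreducible_wChain hr hl hr2 hr2' hr4).2

theorem irreducible_wVec (hr : r ≠ 0) (hl : 1 / r ≠ 0) (hr2 : r ^ 2 ≠ 1) (hr2' : r ^ 2 ≠ -1)
    (hr4 : r ^ 4 ≠ -1) :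
    IsIrreducibleInvariant (nu r (1 / r) hr hl hr2) (Submodule.span K (Set.range (wVec r))) ∧
      Module.finrank K (Submodule.span K (Set.range (wVec r))) = 3 :=
  span_wChain hr hl hr2 hr2' hr4 ▸ irreducible_wChain hr hl hr2 hr2' hr4

theorem irreducible_vVec (hr : r ≠ 0) (hl : 1 / r ≠ 0) (hr2 : r ^ 2 ≠ 1) (hr2' : r ^ 2 ≠ -1)
    (hr4 : r ^ 4 ≠ -1) :
    IsIrreducibleInvariant (nu r (1 / r) hr hl hr2) (Submodule.span K (Set.range (vVec r))) ∧
      Module.finrank K (Submodule.span K (Set.range (vVec r))) = 3 :=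
  irreducible_of_chain hr hl hr2 hr2' hr4 (inv_mul_cancel₀ hr) (inv_mul_cancel₀ hr) vVec_ne_zero
    (κ := vNode) (fun i => by fin_cases i; exacts [⟨.n1, rfl⟩, ⟨.n3, rfl⟩, ⟨.n4, rfl⟩])
    (gOp_vVec hr)

theorem eFun_n3_orbitVec (hm : mParam r ≠ 0) (a b c p q s : K) :
    eFun r (1 / r) .n3 (orbitVec a b c p q s) =
      p + q + s + r + b * c * r⁻¹ + a⁻¹ * b⁻¹ * r + a⁻¹ * c * r⁻¹ := by
  -- The coefficient of `e₃` on `w₂₃` vanishes, because `l - l⁻¹ = m`.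
  have h : 1 - (1 / r - (1 / r)⁻¹) * (mParam r)⁻¹ = 0 := by
    rw [one_div, inv_inv, ← mParam, mul_inv_cancel₀ hm, sub_self]
  rw [eFun_n3, h]
  simp only [orbitVec, one_div, inv_inv]
  ring

theorem orbitVec_eq_uChain_zero (hr : r ≠ 0) :
    orbitVec r (-r⁻¹) (-r⁻¹) 0 0 0 = uChain r 0 := by
  ext t
  cases t <;> simp [orbitVec, uChain, uVec, bv, mParam] <;> field_simp <;> ring

theorem orbitVec_eq_uChain_two (hr : r ≠ 0) :
    orbitVec (-r⁻¹) r r (r⁻¹ - r ^ 3) 0 (r ^ 3 - r⁻¹) = uChain r 2 := by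
  ext t
  cases t <;> simp [orbitVec, uChain, uVec, bv, mParam] <;> field_simp <;> ring

theorem orbitVec_eq_wChain_zero (hr : r ≠ 0) :
    orbitVec (-r⁻¹) r (-r⁻¹) 0 0 0 = wChain r 0 := by
  ext t
  cases t <;> simp [orbitVec, wChain, wVec, bv, mParam] <;> field_simp

theorem orbitVec_eq_wChain_two (hr : r ≠ 0) :
    orbitVec r (-r⁻¹) r 0 0 0 = wChain r 2 := by
  ext t
  cases t <;> simp [orbitVec, wChain, wVec, bv, mParam] <;> field_simp <;> ring

theorem orbitVec_eq_vVec_zero (hr : r ≠ 0) :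
    orbitVec (-r⁻¹) (-r⁻¹) r (r⁻¹ - r ^ 3) 0 0 = vVec r 0 := by
  ext t
  cases t <;> simp [orbitVec, vVec, bv] <;> field_simp

theorem orbitVec_eq_smul_vVec_two (hr : r ≠ 0) :
    orbitVec r r (-r⁻¹) 0 (r⁻¹ ^ 3 - r) 0 = r⁻¹ ^ 2 • vVec r 2 := by
  ext t
  cases t <;> simp [orbitVec, vVec, bv] <;> field_simp <;> simp [hr]

/-- For `l = 1/r` the joint eigenvectors killed by `e₃` lie in the three subspaces. -/
theorem orbitVec_mem (hr : r ≠ 0) (hm : mParam r ≠ 0) {β : K} {x : V4 K}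
    (h3 : eFun r (1 / r) .n3 x = 0)
    (h : x = orbitVec r r (-r⁻¹) 0 β 0 ∨ x = orbitVec r (-r⁻¹) r β 0 0 ∨
      x = orbitVec (-r⁻¹) r r (r⁻¹ - r ^ 3) 0 β ∨ x = orbitVec r (-r⁻¹) (-r⁻¹) 0 0 0 ∨
      x = orbitVec (-r⁻¹) r (-r⁻¹) 0 0 0 ∨
      x = orbitVec (-r⁻¹) (-r⁻¹) r (r⁻¹ - r ^ 3) 0 0) :
    x ∈ Submodule.span K (Set.range (uVec r)) ∨ x ∈ Submodule.span K (Set.range (wVec r)) ∨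
      x ∈ Submodule.span K (Set.range (vVec r)) := by
  rcases h with rfl | rfl | rfl | rfl | rfl | rfl
  · rw [eFun_n3_orbitVec hm] at h3
    have hβ : β = r⁻¹ ^ 3 - r := by
      field_simp at h3 ⊢
      linear_combination h3
    rw [hβ, orbitVec_eq_smul_vVec_two hr]
    exact .inr (.inr (Submodule.smul_mem _ _ (Submodule.subset_span ⟨2, rfl⟩)))
  · rw [eFun_n3_orbitVec hm] at h3
    have hβ : β = 0 := by
      field_simp at h3
      refine mul_left_cancel₀ hr ?_
      linear_combination h3
    rw [hβ, orbitVec_eq_wChain_two hr]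
    exact .inr (.inl (wChain_mem r 2))
  · rw [eFun_n3_orbitVec hm] at h3
    have hβ : β = r ^ 3 - r⁻¹ := by
      field_simp at h3 ⊢
      linear_combination h3
    rw [hβ, orbitVec_eq_uChain_two hr]
    exact .inl (uChain_mem r 2)
  · rw [orbitVec_eq_uChain_zero hr]
    exact .inl (uChain_mem r 0)
  · rw [orbitVec_eq_wChain_zero hr]
    exact .inr (.inl (wChain_mem r 0))
  · rw [orbitVec_eq_vVec_zero hr]
    exact .inr (.inr (Submodule.subset_span ⟨0, rfl⟩))

theorem eq_of_common_vector {A V : Type*} [Ring A] [Algebra K A] [AddCommGroup V] [Module K V]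
    {ρ : A →ₐ[K] Module.End K V} {U W : Submodule K V} (hU : IsIrreducibleInvariant ρ U)
    (hW : IsIrreducibleInvariant ρ W) {x : V} (hx : x ≠ 0) (hxU : x ∈ U) (hxW : x ∈ W) :
    W = U := by
  have hinv : IsInvariant ρ (U ⊓ W) := fun a v hv => ⟨hU.1 a v hv.1, hW.1 a v hv.2⟩
  have hne : U ⊓ W ≠ ⊥ := (Submodule.ne_bot_iff _).mpr ⟨x, ⟨hxU, hxW⟩, hx⟩
  rw [← (hU.2.2 _ inf_le_left hinv).resolve_left hne]
  exact ((hW.2.2 _ inf_le_right hinv).resolve_left hne).symm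

/-- A span on which `g_k` and `g_k'` agree does not contain an eigenvector on which they have
different eigenvalues. -/
theorem span_ne_of_eigenvector (hs : r ≠ -r⁻¹) {k k' : Node} {p : Fin 3 → V4 K}
    (hp : ∀ j, gOp r l k (p j) = gOp r l k' (p j)) {x : V4 K} (hx : x ≠ 0)
    (h1 : gOp r l k x = r • x) (h2 : gOp r l k' x = (-r⁻¹) • x) {U : Submodule K (V4 K)}
    (hxU : x ∈ U) : U ≠ Submodule.span K (Set.range p) := by
  rintro rfl
  have : ∀ y ∈ Submodule.span K (Set.range p), gOp r l k y = gOp r l k' y := by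
    intro y hy
    obtain ⟨a, rfl⟩ := (Submodule.mem_span_range_iff_exists_fun K).mp hy
    simp only [map_sum, map_smul, hp]
  have h := this x hxU
  rw [h1, h2] at h
  exact hs (smul_left_injective K hx h)

/-- The three subspaces are distinct: each pair of outer generators agrees on just one. -/
theorem spans_ne (hr : r ≠ 0) (hl : 1 / r ≠ 0) (hr2 : r ^ 2 ≠ 1) (hr2' : r ^ 2 ≠ -1)
    (hr4 : r ^ 4 ≠ -1) :
    Submodule.span K (Set.range (uVec r)) ≠ Submodule.span K (Set.range (wVec r)) ∧
    Submodule.span K (Set.range (uVec r)) ≠ Submodule.span K (Set.range (vVec r)) ∧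
    Submodule.span K (Set.range (wVec r)) ≠ Submodule.span K (Set.range (vVec r)) := by
  have hs : r ≠ -r⁻¹ := by
    intro hs
    apply hr2'
    field_simp at hs
    exact hs
  have u1 : gOp r (1 / r) .n1 (uChain r 0) = r • uChain r 0 := by
    rw [gOp_uChain hr]
    simp [uNode, chainMatrix]
  have u2 : gOp r (1 / r) .n2 (uChain r 0) = (-r⁻¹) • uChain r 0 := by
    rw [gOp_uChain hr]
    simp only [uNode, chainMatrix, Matrix.of_apply, Matrix.cons_val_zero]
    module
  have u4 : gOp r (1 / r) .n4 (uChain r 0) = (-r⁻¹) • uChain r 0 := u2 ▸ by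
    rw [gOp_uChain hr, gOp_uChain hr]; rfl
  have w1 : gOp r (1 / r) .n1 (wChain r 2) = r • wChain r 2 := by
    rw [gOp_wChain hr]
    simp [wNode, chainMatrix]
  have w2 : gOp r (1 / r) .n2 (wChain r 2) = (-r⁻¹) • wChain r 2 := by
    rw [gOp_wChain hr]
    simp only [wNode, chainMatrix, Matrix.of_apply, Matrix.cons_val]
    module
  have hw : ∀ j, gOp r (1 / r) .n1 (wChain r j) = gOp r (1 / r) .n4 (wChain r j) := fun j => by
    rw [gOp_wChain hr, gOp_wChain hr]; rfl
  have hv : ∀ j, gOp r (1 / r) .n1 (vVec r j) = gOp r (1 / r) .n2 (vVec r j) := fun j => by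
    rw [gOp_vVec hr, gOp_vVec hr]; rfl
  refine ⟨?_, ?_, ?_⟩
  · rw [← span_wChain hr hl hr2 hr2' hr4]
    exact span_ne_of_eigenvector hs hw (uChain_ne_zero hr 0) u1 u4 (uChain_mem r 0)
  · exact span_ne_of_eigenvector hs hv (uChain_ne_zero hr 0) u1 u2 (uChain_mem r 0)
  · exact span_ne_of_eigenvector hs hv (wChain_ne_zero 2) w1 w2 (wChain_mem r 2)

end CohenWales

theorem corollary1 {K : Type*} [Field K] [CharZero K] (r l : K) (hr : r ≠ 0) (hl : l ≠ 0)
    (hss : ∀ k : ℕ, 1 ≤ k → k ≤ 3 → r ^ (2 * k) ≠ 1 ∧ r ^ (2 * k) ≠ -1)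
    (hss' : r ^ (2 * 4) ≠ 1) (hr2 : r ^ 2 ≠ 1) :
    ((∃ W : Submodule K (CohenWales.V4 K),
        CohenWales.IsIrreducibleInvariant (CohenWales.nu r l hr hl hr2) W ∧
          Module.finrank K W = 3) ↔ l = 1 / r) ∧
    (l = 1 / r →
      {W : Submodule K (CohenWales.V4 K) |
        CohenWales.IsIrreducibleInvariant (CohenWales.nu r l hr hl hr2) W ∧
          Module.finrank K W = 3} =
        {Submodule.span K (Set.range (CohenWales.uVec r)),
          Submodule.span K (Set.range (CohenWales.wVec r)),
          Submodule.span K (Set.range (CohenWales.vVec r))} ∧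
      {W : Submodule K (CohenWales.V4 K) |
        CohenWales.IsIrreducibleInvariant (CohenWales.nu r l hr hl hr2) W ∧
          Module.finrank K W = 3}.ncard = 3) := by
  have hr2' : r ^ 2 ≠ -1 := (hss 1 le_rfl (by decide)).2
  have hr4 : r ^ 4 ≠ 1 ∧ r ^ 4 ≠ -1 := hss 2 (by decide) (by decide)
  have hm := CohenWales.mParam_ne_zero hr hr2
  have hvec : ∀ W : Submodule K (CohenWales.V4 K),
      CohenWales.IsIrreducibleInvariant (CohenWales.nu r l hr hl hr2) W →
        Module.finrank K W = 3 → ∃ β : K, ∃ x ∈ W, x ≠ 0 ∧ CohenWales.eFun r l .n3 x = 0 ∧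
          (x = CohenWales.orbitVec r r (-r⁻¹) 0 β 0 ∨ x = CohenWales.orbitVec r (-r⁻¹) r β 0 0 ∨
            x = CohenWales.orbitVec (-r⁻¹) r r (r⁻¹ - r ^ 3) 0 β ∨
            x = CohenWales.orbitVec r (-r⁻¹) (-r⁻¹) 0 0 0 ∨
            x = CohenWales.orbitVec (-r⁻¹) r (-r⁻¹) 0 0 0 ∨
            x = CohenWales.orbitVec (-r⁻¹) (-r⁻¹) r (r⁻¹ - r ^ 3) 0 0) := by
    intro W hW hdim
    have hWg := (CohenWales.isInvariant_iff hr hl hr2 W).mp hW.1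
    have htop := CohenWales.ne_top_of_finrank hdim
    obtain ⟨a, b, c, v, hv, hv0, h1, h2, h4, hpat⟩ :=
      CohenWales.exists_nonconstant_eigenvector hr hl hr2 hW hdim
    obtain ⟨t, β, ht, hx⟩ := CohenWales.eq_smul_orbitVec hr hr2' hv0 h1 h2 h4
      (CohenWales.eFun_eq_zero hr hl hm hWg htop .n3 hv) hpat
    have hxW := W.smul_mem t⁻¹ hv
    refine ⟨β, t⁻¹ • v, hxW, smul_ne_zero (inv_ne_zero ht) hv0,
      CohenWales.eFun_eq_zero hr hl hm hWg htop .n3 hxW, ?_⟩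
    simpa only [inv_smul_eq_iff₀ ht] using hx
  have hl1 : ∀ W : Submodule K (CohenWales.V4 K),
      CohenWales.IsIrreducibleInvariant (CohenWales.nu r l hr hl hr2) W →
        Module.finrank K W = 3 → l = 1 / r := by
    intro W hW hdim
    obtain ⟨β, x, hxW, -, -, hx⟩ := hvec W hW hdim
    refine CohenWales.eq_one_div_of_orbitVec_mem hr hl hr4.1 hdim
      ((CohenWales.isInvariant_iff hr hl hr2 W).mp hW.1) (β := β) ?_
    rcases hx with rfl | rfl | rfl | rfl | rfl | rfl <;> simp only [hxW, true_or, or_true]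
  refine ⟨⟨fun ⟨W, hW, hdim⟩ => hl1 W hW hdim, ?_⟩, ?_⟩
  · rintro rfl
    exact ⟨_, CohenWales.irreducible_uVec hr hl hr2 hr2' hr4.2⟩
  · rintro rfl
    have hu := CohenWales.irreducible_uVec hr hl hr2 hr2' hr4.2
    have hw := CohenWales.irreducible_wVec hr hl hr2 hr2' hr4.2
    have hv := CohenWales.irreducible_vVec hr hl hr2 hr2' hr4.2
    have hset : {W : Submodule K (CohenWales.V4 K) |
        CohenWales.IsIrreducibleInvariant (CohenWales.nu r (1 / r) hr hl hr2) W ∧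
          Module.finrank K W = 3} =
        {Submodule.span K (Set.range (CohenWales.uVec r)),
          Submodule.span K (Set.range (CohenWales.wVec r)),
          Submodule.span K (Set.range (CohenWales.vVec r))} := by
      ext W
      constructor
      · rintro ⟨hW, hdim⟩
        obtain ⟨β, x, hxW, hx0, h3, hx⟩ := hvec W hW hdim
        rcases CohenWales.orbitVec_mem hr hm h3 hx with h | h | h
        · exact .inl (CohenWales.eq_of_common_vector hu.1 hW hx0 h hxW)
        · exact .inr (.inl (CohenWales.eq_of_common_vector hw.1 hW hx0 h hxW))
        · exact .inr (.inr (CohenWales.eq_of_common_vector hv.1 hW hx0 h hxW))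
      · rintro (rfl | rfl | rfl)
        exacts [hu, hw, hv]
    obtain ⟨h1, h2, h3⟩ := CohenWales.spans_ne hr hl hr2 hr2' hr4.2
    exact ⟨hset, by rw [hset]; exact Set.ncard_eq_three.mpr ⟨_, _, _, h1, h2, h3, rfl⟩⟩
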